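/- Let $p_1,p_2,\alpha_0,\alpha_1,\beta_0,\beta_1,\gamma_0,\gamma_1,\delta_0,\delta_1$ be real numbers with $p_1\neq0$, $p_2\neq0$, $|\alpha_0|+|\alpha_1|\neq0$, $|\beta_0|+|\beta_1|\neq0$, and put $p(x)=p_1$ for $x\in[-1,0)$ and $p(x)=p_2$ for $x\in(0,1]$. Let $W_2^2(a,b)$ denote the Sobolev space of all $f\in L_2(a,b)$ (complex-valued) with generalized derivatives $f',f''\in L_2(a,b)$ and inner product $\sum_{k=0}^2\langle f^{(k)},g^{(k)}\rangle_{L_2(a,b)}$; direct sums carry the Hilbert space norm. Suppose that 1. $p_1\delta_0=p_2\gamma_1$; 2. $A$ is a linear operator that acts compactly from $W_2^2(-1,0)\oplus W_2^2(0,1)$ to $L_2(-1,0)\oplus L_2(0,1)$. Let $\pounds$ be the operator $\pounds u=p(x)u''+Au$ in the Hilbert space $L_2(-1,0)\oplus L_2(0,1)$ whose domain consists of all $u\in W_2^2(-1,0)\oplus W_2^2(0,1)$ with $$\alpha_0u(-1)+\alpha_1u'(-1)=0,\qquad \beta_0u(1)+\beta_1u'(1)=0,$$ $$u'(0^-)=\gamma_0u(0^-)+\delta_0u(0^+),\qquad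 u'(0^+)=\gamma_1u(0^-)+\delta_1u(0^+).$$ Then for every $\epsilon>0$ there exist $R_\epsilon>0$ and $C(\epsilon)>0$ such that every $\lambda\in\mathbb C$ with $|\arg\lambda|>\epsilon$, $|\arg(-\lambda)|>\epsilon$ and $|\lambda|>R_\epsilon$ (where $\arg$ takes values in $(-\pi,\pi]$) is a regular value of $\pounds$, i.e. $\lambda I-\pounds$ maps the domain of $\pounds$ bijectively onto $L_2(-1,0)\oplus L_2(0,1)$ with bounded inverse $R(\lambda,\pounds)=(\lambda I-\pounds)^{-1}$, and the norm of $R(\lambda,\pounds)$ as an operator on $L_2(-1,0)\oplus L_2(0,1)$ satisfies $$\|R(\lambda,\pounds)\|\le C(\epsilon)\,|\lambda|^{-1}.$$ -/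

import Mathlib

open MeasureTheory Set
open scoped ContDiff

noncomputable section

/-- The complex Hilbert space `L₂(a, b)`. -/
abbrev L2Space (a b : ℝ) : Type := Lp ℂ 2 (volume.restrict (Ioo a b))

/-- `g` is the generalized (weak) derivative of `f` on `(a, b)`:
`∫ φ' f = - ∫ φ g` for every test function `φ ∈ C₀^∞(a, b)`. -/
def IsWeakDeriv {a b : ℝ} (f g : L2Space a b) : Prop :=
  ∀ φ : ℝ → ℝ, ContDiff ℝ ∞ φ → HasCompactSupport φ → tsupport φ ⊆ Ioo a b →
    ∫ x in Ioo a b, deriv φ x • f x = -∫ x in Ioo a b, φ x • g x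

theorem integrable_testFun_smul {a b : ℝ} (f : L2Space a b) {φ : ℝ → ℝ} (hc : Continuous φ)
    (hs : HasCompactSupport φ) : Integrable (fun x => φ x • f x) (volume.restrict (Ioo a b)) := by
  obtain ⟨C, hC⟩ := hs.exists_bound_of_continuous hc
  have hf : Integrable f (volume.restrict (Ioo a b)) :=
    (Lp.memLp f).integrable (by norm_num)
  exact hf.bdd_smul C hc.aestronglyMeasurable (Filter.Eventually.of_forall hC)

theorem IsWeakDeriv.zero {a b : ℝ} : IsWeakDeriv (0 : L2Space a b) 0 := by
  intro φ _ _ _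
  have h0 : ((0 : L2Space a b) : ℝ → ℂ) =ᵐ[volume.restrict (Ioo a b)] 0 := Lp.coeFn_zero _ _ _
  rw [integral_congr_ae (g := fun _ => (0 : ℂ))
      (h0.mono fun x hx => by simp only [hx, Pi.zero_apply, smul_zero]),
    integral_congr_ae (f := fun x => φ x • (0 : L2Space a b) x) (g := fun _ => (0 : ℂ))
      (h0.mono fun x hx => by simp only [hx, Pi.zero_apply, smul_zero])]
  simp

theorem IsWeakDeriv.add {a b : ℝ} {f g f' g' : L2Space a b} (h : IsWeakDeriv f g)
    (h' : IsWeakDeriv f' g') : IsWeakDeriv (f + f') (g + g') := by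
  intro φ hφ hs ht
  have hd : Continuous (deriv φ) := hφ.continuous_deriv (by simp)
  rw [integral_congr_ae (g := fun x => deriv φ x • f x + deriv φ x • f' x)
      ((Lp.coeFn_add f f').mono fun x hx => by simp only [hx, Pi.add_apply, smul_add]),
    integral_congr_ae (f := fun x => φ x • (g + g') x) (g := fun x => φ x • g x + φ x • g' x)
      ((Lp.coeFn_add g g').mono fun x hx => by simp only [hx, Pi.add_apply, smul_add]),
    integral_add (integrable_testFun_smul f hd hs.deriv) (integrable_testFun_smul f' hd hs.deriv),
    integral_add (integrable_testFun_smul g hφ.continuous hs)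
      (integrable_testFun_smul g' hφ.continuous hs), h φ hφ hs ht, h' φ hφ hs ht, neg_add]

theorem IsWeakDeriv.smul {a b : ℝ} {f g : L2Space a b} (c : ℂ) (h : IsWeakDeriv f g) :
    IsWeakDeriv (c • f) (c • g) := by
  intro φ hφ hs ht
  rw [integral_congr_ae (g := fun x => c • (deriv φ x • f x))
      ((Lp.coeFn_smul c f).mono fun x hx => by
        simp only [hx, Pi.smul_apply, smul_comm c (deriv φ x)]),
    integral_congr_ae (f := fun x => φ x • (c • g) x) (g := fun x => c • (φ x • g x))
      ((Lp.coeFn_smul c g).mono fun x hx => by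
        simp only [hx, Pi.smul_apply, smul_comm c (φ x)]),
    integral_smul, integral_smul, h φ hφ hs ht, smul_neg]

theorem IsWeakDeriv.eq_zero {a b : ℝ} {g : L2Space a b} (h : IsWeakDeriv 0 g) : g = 0 := by
  have hg : IntegrableOn g (Ioo a b) volume :=
    (Lp.memLp g).integrable (by norm_num)
  have key := isOpen_Ioo.ae_eq_zero_of_integral_contDiff_smul_eq_zero hg.locallyIntegrableOn
    (fun φ hφ hs ht => by
      have h1 := h φ hφ hs ht
      have h0 : ((0 : L2Space a b) : ℝ → ℂ) =ᵐ[volume.restrict (Ioo a b)] 0 :=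
        Lp.coeFn_zero _ _ _
      rw [integral_congr_ae (g := fun _ => (0 : ℂ))
      (h0.mono fun x hx => by simp only [hx, Pi.zero_apply, smul_zero]),
        integral_zero, eq_comm, neg_eq_zero] at h1
      rw [← h1]
      refine (setIntegral_eq_integral_of_forall_compl_eq_zero fun x hx => ?_).symm
      rw [image_eq_zero_of_notMem_tsupport fun hx' => hx (ht hx'), zero_smul])
  rw [Lp.eq_zero_iff_ae_eq_zero]
  exact (ae_restrict_iff' measurableSet_Ioo).2 key

/-- The Sobolev space `W₂ⁿ(a, b)`. A function `f` is represented by the tuple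
`(f, f', …, f⁽ⁿ⁾)` of its generalized derivatives, all in `L₂(a, b)`, so that the inner product
inherited from the `ℓ₂`-product is `∑ₖ ⟨f⁽ᵏ⁾, g⁽ᵏ⁾⟩`. -/
def SobolevSpace (n : ℕ) (a b : ℝ) :
    Submodule ℂ (PiLp 2 (fun _ : Fin (n + 1) => L2Space a b)) where
  carrier := {u | ∀ k : Fin n, IsWeakDeriv (u k.castSucc) (u k.succ)}
  zero_mem' := fun _ => IsWeakDeriv.zero
  add_mem' := fun hu hv k => (hu k).add (hv k)
  smul_mem' := fun c _ hu k => (hu k).smul c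

/-- `L₂(-1, 0) ⊕ L₂(0, 1)` with its Hilbert space norm. -/
abbrev L2Sum : Type := WithLp 2 (L2Space (-1) 0 × L2Space 0 1)

/-- `W₂²(-1, 0) ⊕ W₂²(0, 1)` with its Hilbert space norm. -/
abbrev W22Sum : Type := WithLp 2 (SobolevSpace 2 (-1) 0 × SobolevSpace 2 0 1)

/-- The generalized derivative of order `k ≤ 2` on the left interval `(-1, 0)`. -/
def derivLeft (k : Fin 3) (u : W22Sum) : L2Space (-1) 0 := u.fst.1 k

/-- The generalized derivative of order `k ≤ 2` on the right interval `(0, 1)`. -/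
def derivRight (k : Fin 3) (u : W22Sum) : L2Space 0 1 := u.snd.1 k

/-- The embedding `W₂²(-1, 0) ⊕ W₂²(0, 1) ⊂ L₂(-1, 0) ⊕ L₂(0, 1)`. -/
def W22Sum.toL2 : W22Sum →ₗ[ℂ] L2Sum where
  toFun u := WithLp.toLp 2 (derivLeft 0 u, derivRight 0 u)
  map_add' _ _ := rfl
  map_smul' _ _ := rfl

theorem SobolevSpace.eq_zero {a b : ℝ} (u : SobolevSpace 2 a b) (h : u.1 0 = 0) : u = 0 := by
  have h01 : IsWeakDeriv (u.1 0) (u.1 1) := u.2 0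
  have h12 : IsWeakDeriv (u.1 1) (u.1 2) := u.2 1
  rw [h] at h01
  have h1 := h01.eq_zero
  rw [h1] at h12
  have h2 := h12.eq_zero
  apply Subtype.ext
  ext1 k
  fin_cases k
  · exact h
  · exact h1
  · exact h2

theorem W22Sum.toL2_injective : Function.Injective W22Sum.toL2 := by
  rw [← LinearMap.ker_eq_bot, LinearMap.ker_eq_bot']
  intro u hu
  have h1 : u.fst.1 0 = 0 := congrArg WithLp.fst hu
  have h2 : u.snd.1 0 = 0 := congrArg WithLp.snd hu
  have e1 := SobolevSpace.eq_zero _ h1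
  have e2 := SobolevSpace.eq_zero _ h2
  apply WithLp.ofLp_injective 2
  exact Prod.ext e1 e2

/-- `F` is a continuous representative of `f` on the closed interval `[a, b]`. Elements of
`W₂¹(a, b)` have exactly one, and its values at `a` and `b` are the boundary values of `f`. -/
def IsContRep {a b : ℝ} (f : L2Space a b) (F : ℝ → ℂ) : Prop :=
  ContinuousOn F (Icc a b) ∧ f =ᵐ[volume.restrict (Ioo a b)] F

theorem IsContRep.zero {a b : ℝ} : IsContRep (0 : L2Space a b) 0 :=
  ⟨continuousOn_const, Lp.coeFn_zero _ _ _⟩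

theorem IsContRep.add {a b : ℝ} {f g : L2Space a b} {F G : ℝ → ℂ} (hf : IsContRep f F)
    (hg : IsContRep g G) : IsContRep (f + g) (F + G) :=
  ⟨hf.1.add hg.1, (Lp.coeFn_add f g).trans (hf.2.add hg.2)⟩

theorem IsContRep.smul {a b : ℝ} {f : L2Space a b} {F : ℝ → ℂ} (c : ℂ) (hf : IsContRep f F) :
    IsContRep (c • f) (c • F) :=
  ⟨hf.1.const_smul c, (Lp.coeFn_smul c f).trans (hf.2.const_smul c)⟩

/-- The real coefficients of the differential expression, of the boundary conditions at `-1`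
and `1`, and of the transmission conditions at `0`. -/
structure TransmissionData where
  p₁ : ℝ
  p₂ : ℝ
  α₀ : ℝ
  α₁ : ℝ
  β₀ : ℝ
  β₁ : ℝ
  γ₀ : ℝ
  γ₁ : ℝ
  δ₀ : ℝ
  δ₁ : ℝ

/-- The conditions `L₁u = L₂u = L₃u = L₄u = 0`. Here `U`, `U'` represent `u`, `u'` on `[-1, 0]`
and `V`, `V'` represent `u`, `u'` on `[0, 1]`, so that `u(0⁻) = U 0` and `u(0⁺) = V 0`. -/
def boundarySubmodule (c : TransmissionData) : Submodule ℂ W22Sum where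
  carrier := {u | ∃ U U' V V' : ℝ → ℂ,
    IsContRep (derivLeft 0 u) U ∧ IsContRep (derivLeft 1 u) U' ∧
    IsContRep (derivRight 0 u) V ∧ IsContRep (derivRight 1 u) V' ∧
    c.α₀ * U (-1) + c.α₁ * U' (-1) = 0 ∧
    c.β₀ * V 1 + c.β₁ * V' 1 = 0 ∧
    U' 0 - c.γ₀ * U 0 - c.δ₀ * V 0 = 0 ∧
    V' 0 - c.γ₁ * U 0 - c.δ₁ * V 0 = 0}
  zero_mem' := ⟨0, 0, 0, 0, IsContRep.zero, IsContRep.zero, IsContRep.zero, IsContRep.zero,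
    by simp, by simp, by simp, by simp⟩
  add_mem' := by
    rintro u v ⟨U, U', V, V', h1, h2, h3, h4, e1, e2, e3, e4⟩
      ⟨X, X', Y, Y', k1, k2, k3, k4, d1, d2, d3, d4⟩
    refine ⟨U + X, U' + X', V + Y, V' + Y', h1.add k1, h2.add k2, h3.add k3, h4.add k4,
      ?_, ?_, ?_, ?_⟩ <;> simp only [Pi.add_apply]
    · linear_combination e1 + d1
    · linear_combination e2 + d2
    · linear_combination e3 + d3
    · linear_combination e4 + d4
  smul_mem' := by
    rintro z u ⟨U, U', V, V', h1, h2, h3, h4, e1, e2, e3, e4⟩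
    refine ⟨z • U, z • U', z • V, z • V', h1.smul z, h2.smul z, h3.smul z, h4.smul z,
      ?_, ?_, ?_, ?_⟩ <;> simp only [Pi.smul_apply, smul_eq_mul]
    · linear_combination z * e1
    · linear_combination z * e2
    · linear_combination z * e3
    · linear_combination z * e4

/-- The principal part `u ↦ p(x) u''`, where `p = p₁` on `(-1, 0)` and `p = p₂` on `(0, 1)`. -/
def principalPart (c : TransmissionData) : W22Sum →ₗ[ℂ] L2Sum where
  toFun u := WithLp.toLp 2 ((c.p₁ : ℂ) • derivLeft 2 u, (c.p₂ : ℂ) • derivRight 2 u)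
  map_add' _ _ := congrArg (WithLp.toLp 2) (Prod.ext (smul_add _ _ _) (smul_add _ _ _))
  map_smul' z u := congrArg (WithLp.toLp 2) (Prod.ext
    (smul_comm (c.p₁ : ℂ) z (derivLeft 2 u)) (smul_comm (c.p₂ : ℂ) z (derivRight 2 u)))

/-- The unbounded operator `u ↦ p(x) u'' + A u` in `L₂(-1, 0) ⊕ L₂(0, 1)`, whose domain consists
of the `u ∈ W₂²(-1, 0) ⊕ W₂²(0, 1)` that satisfy the boundary and transmission conditions. -/
def transmissionOperator (c : TransmissionData) (A : W22Sum →ₗ[ℂ] L2Sum) : L2Sum →ₗ.[ℂ] L2Sum where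
  domain := (boundarySubmodule c).map W22Sum.toL2
  toFun := (principalPart c + A) ∘ₗ (boundarySubmodule c).subtype ∘ₗ
    ((boundarySubmodule c).equivMapOfInjective W22Sum.toL2
      W22Sum.toL2_injective).symm.toLinearMap

/-- `R` is the bounded, everywhere defined, two-sided inverse of `z I - T : D(T) → H`. -/
structure IsResolventAt {H : Type*} [NormedAddCommGroup H] [NormedSpace ℂ H]
    (T : H →ₗ.[ℂ] H) (z : ℂ) (R : H →L[ℂ] H) : Prop where
  right_inv : ∀ f : H, ∃ h : R f ∈ T.domain, z • R f - T ⟨R f, h⟩ = f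
  left_inv : ∀ u : T.domain, R (z • (u : H) - T u) = u

/-- `z` is a regular value of `T` (it belongs to the resolvent set of `T`). -/
def IsRegularValue {H : Type*} [NormedAddCommGroup H] [NormedSpace ℂ H]
    (T : H →ₗ.[ℂ] H) (z : ℂ) : Prop :=
  ∃ R : H →L[ℂ] H, IsResolventAt T z R

open Classical in
/-- The resolvent operator `R(z, T) = (z I - T)⁻¹` (zero if `z` is not a regular value). -/
def resolventOperator {H : Type*} [NormedAddCommGroup H] [NormedSpace ℂ H]
    (T : H →ₗ.[ℂ] H) (z : ℂ) : H →L[ℂ] H :=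
  if h : IsRegularValue T z then h.choose else 0

theorem IsResolventAt.eq_resolventOperator {H : Type*} [NormedAddCommGroup H] [NormedSpace ℂ H]
    {T : H →ₗ.[ℂ] H} {z : ℂ} {R : H →L[ℂ] H} (hR : IsResolventAt T z R) :
    R = resolventOperator T z := by
  have h : IsRegularValue T z := ⟨R, hR⟩
  rw [resolventOperator, dif_pos h]
  ext f
  obtain ⟨hf, e⟩ := h.choose_spec.right_inv f
  have := hR.left_inv ⟨_, hf⟩
  rw [e] at this
  exact this

end

noncomputable section

/-! Write `z u - p u'' = f`. On each interval, dividing by `p`, pairing with `u` and integrating by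
parts expresses `μ ‖u‖² + ‖u'‖²`, with `μ = z / p`, as the pairing of `u` with `f / p` plus boundary
terms. Since `p` is real and nonzero, `μ` stays in a double sector around the imaginary axis
whatever the sign of `p`, so the modulus of this sum controls `|μ| ‖u‖² + ‖u'‖²`. The boundary and
transmission conditions make every boundary term quadratic in boundary values of `u` alone, and the
trace inequality bounds these by a small multiple of `‖u'‖²` plus a large multiple of `‖u‖²`. The
former is absorbed at once, the latter for large `|z|`. With `u''` read off from the equation this
is `exists_apriori_estimate`: `|z| ‖u‖` in `L₂` and the full `W₂²` norm are both at most `C ‖f‖`.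

The estimate contains uniqueness, and existence follows by linear algebra in
`exists_mem_boundarySubmodule_resolventPrincipal_eq`: a particular solution is corrected by
exponentials, whose four coefficients solve an injective, hence surjective, square system.

The compact operator `A` is a perturbation. By Ehrling's inequality
(`IsCompactOperator.exists_norm_le_add`), `‖A u‖` is at most a small multiple of the `W₂²` norm plus
a multiple of the `L₂` norm, hence at most `‖f‖ / 2` for large `|z|`; a Neumann series
(`exists_isResolventAt`) then yields the resolvent and its bound. -/

/-! ### Absolutely continuous functions and the product rule. -/

/-- Real and imaginary parts are treated separately and recombined as scalar multiples of the
constants `1` and `I`. -/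
theorem absolutelyContinuousOnInterval_integral_complex {h : ℝ → ℂ} {a b : ℝ}
    (hh : IntervalIntegrable h volume a b) :
    AbsolutelyContinuousOnInterval (fun x => ∫ t in a..x, h t) a b := by
  have hre : IntervalIntegrable (fun t => (h t).re) volume a b :=
    ⟨hh.1.re, hh.2.re⟩
  have him : IntervalIntegrable (fun t => (h t).im) volume a b :=
    ⟨hh.1.im, hh.2.im⟩
  have hc : ∀ z : ℂ, AbsolutelyContinuousOnInterval (fun _ : ℝ => z) a b := fun z =>
    (contDiff_const (n := 1)).contDiffOn.absolutelyContinuousOnInterval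
  have h1 := (hre.absolutelyContinuousOnInterval_intervalIntegral (c := a) (by simp)).fun_smul
    (hc 1)
  have h2 := (him.absolutelyContinuousOnInterval_intervalIntegral (c := a) (by simp)).fun_smul
    (hc Complex.I)
  have h3 := h1.fun_add h2
  unfold AbsolutelyContinuousOnInterval at h3 ⊢
  refine h3.congr' ?_
  rw [Filter.EventuallyEq, Filter.eventually_inf_principal]
  filter_upwards with E hE
  have key : ∀ x ∈ uIcc a b, (∫ t in a..x, (h t).re) • (1 : ℂ)
      + (∫ t in a..x, (h t).im) • Complex.I = ∫ t in a..x, h t := by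
    intro x hx
    have hx' : IntervalIntegrable h volume a x :=
      hh.mono_set (uIcc_subset_uIcc_left hx)
    apply Complex.ext
    · have := Complex.reCLM.intervalIntegral_comp_comm hx'
      simp at this
      simp [this]
    · have := Complex.imCLM.intervalIntegral_comp_comm hx'
      simp at this
      simp [this]
  refine Finset.sum_congr rfl fun i hi => ?_
  have := (hE.1 i hi)
  rw [key _ this.1, key _ this.2]

/-- Product rule for a continuously differentiable function and an absolutely continuous one. -/
theorem integral_product_rule {E E' G h : ℝ → ℂ} {a b : ℝ} (hE : ∀ x, HasDerivAt E (E' x) x)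
    (hE' : Continuous E') (hh : Integrable h) (hG : ∀ x, G x = G a + ∫ t in a..x, h t) :
    ∫ x in a..b, (E' x * G x + E x * h x) = E b * G b - E a * G a := by
  have hEc : Continuous E := continuous_iff_continuousAt.2 fun x => (hE x).continuousAt
  have hGc : Continuous G := by
    rw [funext hG]
    exact continuous_const.add (intervalIntegral.continuous_primitive
      (fun _ _ => hh.intervalIntegrable) a)
  have hi : ∀ c d, IntervalIntegrable (fun x => E' x * G x + E x * h x) volume c d := fun c d =>
    ((hE'.mul hGc).intervalIntegrable c d).add
      ((hh.intervalIntegrable (a := c) (b := d)).continuousOn_mul hEc.continuousOn)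
  have hEac : AbsolutelyContinuousOnInterval E a b := by
    refine ContDiffOn.absolutelyContinuousOnInterval (ContDiff.contDiffOn ?_)
    rw [contDiff_one_iff_deriv]
    refine ⟨fun x => (hE x).differentiableAt, ?_⟩
    rwa [show deriv E = E' from funext fun x => (hE x).deriv]
  have hGac : AbsolutelyContinuousOnInterval G a b := by
    rw [funext hG]
    exact (ContDiffOn.absolutelyContinuousOnInterval
      (contDiff_const (n := 1)).contDiffOn).fun_add
        (absolutelyContinuousOnInterval_integral_complex hh.intervalIntegrable)
  -- `E G` minus the primitive of its almost everywhere derivative is absolutely continuous with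
  -- zero derivative almost everywhere, hence constant.
  have hP := (hEac.fun_smul hGac).fun_sub
    (absolutelyContinuousOnInterval_integral_complex (hi a b))
  obtain ⟨C, hC⟩ := hP.const_of_ae_hasDerivAt_zero (by
    filter_upwards [(hh.intervalIntegrable (a := a) (b := b)).ae_hasDerivAt_integral,
      (hi a b).ae_hasDerivAt_integral] with x h1 h2 hx
    have h1 : HasDerivAt G (h x) x := by
      rw [funext hG]
      exact (h1 hx a (by simp)).const_add _
    have := ((hE x).mul h1).sub (h2 hx a (by simp))
    rw [sub_self] at this
    exact this)
  have h1 := hC a (by simp)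
  have h2 := hC b (by simp)
  simp only [smul_eq_mul, intervalIntegral.integral_same, sub_zero] at h1 h2
  linear_combination h1 - h2

/-! ### Test functions and the du Bois-Reymond lemma. -/

theorem IsCompact.exists_Icc_of_subset_Ioo {a b : ℝ} (hab : a < b) {K : Set ℝ} (hK : IsCompact K)
    (hs : K ⊆ Ioo a b) : ∃ a' b', a < a' ∧ b' < b ∧ K ⊆ Icc a' b' := by
  rcases K.eq_empty_or_nonempty with rfl | hne
  -- The endpoints are swapped, so both strict inequalities are `a < b`.
  · exact ⟨b, a, hab, hab, by simp⟩
  · obtain ⟨m, hm, hm'⟩ := hK.exists_isLeast hne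
    obtain ⟨M, hM, hM'⟩ := hK.exists_isGreatest hne
    exact ⟨m, M, (hs hm).1, (hs hM).2, fun x hx => ⟨hm' hx, hM' hx⟩⟩

/-- The primitive of a test function of mean zero is a test function. -/
theorem exists_testFun_primitive {a b : ℝ} (hab : a < b) {η : ℝ → ℝ} (hη : ContDiff ℝ ∞ η)
    (hc : HasCompactSupport η) (hs : tsupport η ⊆ Ioo a b) (h0 : ∫ x in a..b, η x = 0) :
    ∃ Φ : ℝ → ℝ, ContDiff ℝ ∞ Φ ∧ HasCompactSupport Φ ∧ tsupport Φ ⊆ Ioo a b ∧ deriv Φ = η := by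
  obtain ⟨a', b', ha, hb, hK⟩ := IsCompact.exists_Icc_of_subset_Ioo hab hc hs
  have hz : ∀ x, x ∉ Icc a' b' → η x = 0 := fun x hx =>
    image_eq_zero_of_notMem_tsupport fun h => hx (hK h)
  have hd : ∀ x, HasDerivAt (fun x => ∫ t in a..x, η t) (η x) x := fun x =>
    intervalIntegral.integral_hasDerivAt_right (hη.continuous.intervalIntegrable _ _)
      hη.continuous.stronglyMeasurable.stronglyMeasurableAtFilter hη.continuous.continuousAt
  have hder : deriv (fun x => ∫ t in a..x, η t) = η := funext fun x => (hd x).deriv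
  have hsup : tsupport (fun x => ∫ t in a..x, η t) ⊆ Icc a' b' := by
    refine closure_minimal (fun x hx => ?_) isClosed_Icc
    by_contra hx'
    apply hx
    rcases lt_or_ge x a' with h | h
    · change ∫ t in a..x, η t = 0
      rw [intervalIntegral.integral_congr (g := fun _ => (0 : ℝ)), intervalIntegral.integral_zero]
      intro y hy
      refine hz y fun hy' => ?_
      rcases mem_uIcc.1 hy with h1 | h1 <;> linarith [hy'.1, h1.2]
    · have hxb : b' < x := by
        by_contra h1
        exact hx' ⟨h, not_lt.1 h1⟩
      change ∫ t in a..x, η t = 0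
      -- To the right of the support, mean zero lets the integral start at `b` instead of `a`.
      rw [← intervalIntegral.integral_add_adjacent_intervals
        (hη.continuous.intervalIntegrable a b) (hη.continuous.intervalIntegrable b x), h0, zero_add,
        intervalIntegral.integral_congr (g := fun _ => (0 : ℝ)), intervalIntegral.integral_zero]
      intro y hy
      refine hz y fun hy' => ?_
      rcases mem_uIcc.1 hy with h1 | h1 <;> linarith [hy'.2, h1.1]
  refine ⟨fun x => ∫ t in a..x, η t, ?_, HasCompactSupport.of_support_subset_isCompact
    isCompact_Icc ((subset_tsupport _).trans hsup), hsup.trans (Icc_subset_Ioo ha hb), hder⟩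
  rw [contDiff_infty_iff_deriv, hder]
  exact ⟨fun x => (hd x).differentiableAt, hη⟩

theorem intervalIntegral_eq_setIntegral_Ioo {F : Type*} [NormedAddCommGroup F] [NormedSpace ℝ F]
    {a b : ℝ} (hab : a ≤ b) (h : ℝ → F) : ∫ x in a..b, h x = ∫ x in Ioo a b, h x := by
  rw [intervalIntegral.integral_of_le hab, integral_Ioc_eq_integral_Ioo]

/-- The lemma of du Bois-Reymond. -/
theorem ae_eq_const_of_integral_deriv_smul_eq_zero {a b : ℝ} (hab : a < b) {h : ℝ → ℂ}
    (hh : IntegrableOn h (Ioo a b))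
    (H : ∀ φ : ℝ → ℝ, ContDiff ℝ ∞ φ → HasCompactSupport φ → tsupport φ ⊆ Ioo a b →
      ∫ x in Ioo a b, deriv φ x • h x = 0) :
    ∃ c : ℂ, h =ᵐ[volume.restrict (Ioo a b)] fun _ => c := by
  obtain ⟨ψ, hψs, hψc, hψ, hψr, hψ1⟩ := exists_contDiff_tsupport_subset (n := ⊤)
    (isOpen_Ioo.mem_nhds (show (a + b) / 2 ∈ Ioo a b from ⟨by linarith, by linarith⟩))
  have hψ0 : 0 < ∫ x in a..b, ψ x := by
    apply intervalIntegral.integral_pos hab hψ.continuous.continuousOn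
    · exact fun x _ => (hψr ⟨x, rfl⟩).1
    · exact ⟨(a + b) / 2, ⟨by linarith, by linarith⟩, by rw [hψ1]; exact one_pos⟩
  set I := ∫ x in a..b, ψ x
  have bsm : ∀ {φ : ℝ → ℝ} {k : ℝ → ℂ}, Continuous φ → HasCompactSupport φ →
      IntegrableOn k (Ioo a b) → Integrable (fun x => φ x • k x) (volume.restrict (Ioo a b)) := by
    intro φ k hc hs hk
    obtain ⟨C, hC⟩ := hs.exists_bound_of_continuous hc
    exact hk.bdd_smul C hc.aestronglyMeasurable (Filter.Eventually.of_forall hC)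
  -- The constant must be the average of `h` with weight `ψ`.
  set c : ℂ := (I : ℂ)⁻¹ * ∫ x in Ioo a b, ψ x • h x
  have hcint : IntegrableOn (fun _ : ℝ => c) (Ioo a b) := integrableOn_const (by simp)
  refine ⟨c, ?_⟩
  have key := isOpen_Ioo.ae_eq_zero_of_integral_contDiff_smul_eq_zero
    (f := fun x => h x - c) (U := Ioo a b) (μ := volume)
    (hh.sub hcint).locallyIntegrableOn (by
      intro φ hφ hφc hφs
      set J := ∫ x in a..b, φ x
      have hηc : HasCompactSupport fun x => φ x - J / I * ψ x := by
        refine HasCompactSupport.of_support_subset_isCompact (hφc.isCompact.union hψc.isCompact) ?_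
        intro x hx
        by_contra hx'
        rw [mem_union, not_or] at hx'
        apply hx
        simp [image_eq_zero_of_notMem_tsupport hx'.1, image_eq_zero_of_notMem_tsupport hx'.2]
      have hηs : tsupport (fun x => φ x - J / I * ψ x) ⊆ Ioo a b := by
        refine subset_trans (closure_minimal ?_ (hφc.isCompact.union hψc.isCompact).isClosed)
          (union_subset hφs hψs)
        intro x hx
        by_contra hx'
        rw [mem_union, not_or] at hx'
        apply hx
        simp [image_eq_zero_of_notMem_tsupport hx'.1, image_eq_zero_of_notMem_tsupport hx'.2]
      -- Subtracting the multiple of `ψ` with the same integral as `φ` leaves mean zero, hence the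
      -- derivative of a test function, to which `H` applies.
      obtain ⟨Φ, hΦ, hΦc, hΦs, hΦd⟩ := exists_testFun_primitive hab
        (hφ.sub (contDiff_const.mul hψ)) hηc hηs (by
          rw [intervalIntegral.integral_sub (hφ.continuous.intervalIntegrable _ _)
            ((hψ.continuous.const_mul (J / I)).intervalIntegrable _ _),
            intervalIntegral.integral_const_mul]
          change J - J / I * I = 0
          field_simp
          ring)
      have h1 := H Φ hΦ hΦc hΦs
      rw [hΦd, integral_congr_ae (g := fun x => φ x • h x - (J / I : ℂ) * (ψ x • h x))
          (Filter.Eventually.of_forall fun x => by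
            simp only [Complex.real_smul]; push_cast; ring),
        integral_sub (bsm hφ.continuous hφc hh) ((bsm hψ.continuous hψc hh).const_mul _),
        integral_const_mul] at h1
      have hJ : ∫ x in Ioo a b, φ x • c = J * c := by
        rw [integral_smul_const, ← intervalIntegral_eq_setIntegral_Ioo hab.le, Complex.real_smul]
      rw [← setIntegral_eq_integral_of_forall_compl_eq_zero (s := Ioo a b) fun x hx => by
        rw [image_eq_zero_of_notMem_tsupport fun hx' => hx (hφs hx'), zero_smul]]
      simp only [smul_sub]
      rw [integral_sub (bsm hφ.continuous hφc hh) (bsm hφ.continuous hφc hcint), hJ, ← h1]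
      simp only [c]
      ring)
  refine (ae_restrict_iff' measurableSet_Ioo).2 (key.mono fun x hx hx' => ?_)
  exact sub_eq_zero.1 (hx hx')

/-! ### Weak derivatives and primitives. -/

/-- Extension by zero of a square integrable function on `(a, b)`. -/
def extendZero {a b : ℝ} (f : L2Space a b) : ℝ → ℂ := (Ioo a b).indicator f

theorem integrable_extendZero {a b : ℝ} (f : L2Space a b) : Integrable (extendZero f) :=
  (integrable_indicator_iff measurableSet_Ioo).2 ((Lp.memLp f).integrable (by norm_num))

theorem extendZero_ae_eq {a b : ℝ} (f : L2Space a b) :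
    f =ᵐ[volume.restrict (Ioo a b)] extendZero f :=
  (ae_restrict_iff' measurableSet_Ioo).2
    (Filter.Eventually.of_forall fun _ hx => (indicator_of_mem hx _).symm)

/-- Integration by parts; the boundary terms vanish because the support of `φ` avoids `a` and `b`.
-/
theorem integral_deriv_smul_eq {a b : ℝ} (hab : a < b) (g : L2Space a b) {G : ℝ → ℂ}
    (hG : ∀ x, G x = G a + ∫ t in a..x, extendZero g t) {φ : ℝ → ℝ} (hφ : ContDiff ℝ ∞ φ)
    (hc : HasCompactSupport φ) (hs : tsupport φ ⊆ Ioo a b) :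
    ∫ x in Ioo a b, deriv φ x • G x = -∫ x in Ioo a b, φ x • g x := by
  have hGc : Continuous G := by
    rw [funext hG]
    exact continuous_const.add (intervalIntegral.continuous_primitive
      (fun _ _ => (integrable_extendZero g).intervalIntegrable) a)
  have hd : Continuous (deriv φ) := hφ.continuous_deriv (by simp)
  have h1 := integral_product_rule (a := a) (b := b) (E := fun x => (φ x : ℂ))
    (E' := fun x => ((deriv φ x : ℝ) : ℂ))
    (fun x => ((hφ.differentiable (by simp)).differentiableAt.hasDerivAt).ofReal_comp)
    (Complex.continuous_ofReal.comp hd) (integrable_extendZero g) hG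
  have ha : φ a = 0 := image_eq_zero_of_notMem_tsupport fun h => lt_irrefl _ (hs h).1
  have hb : φ b = 0 := image_eq_zero_of_notMem_tsupport fun h => lt_irrefl _ (hs h).2
  rw [ha, hb, intervalIntegral_eq_setIntegral_Ioo hab.le, integral_add] at h1
  · rw [integral_congr_ae (f := fun x => φ x • g x) (g := fun x => (φ x : ℂ) * extendZero g x)
      ((extendZero_ae_eq g).mono fun x hx => by simp only [Complex.real_smul, hx])]
    simp only [Complex.real_smul]
    rw [Complex.ofReal_zero] at h1
    linear_combination h1
  · exact ((((Complex.continuous_ofReal.comp hd).mul hGc).intervalIntegrable a b).1).mono_set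
      Ioo_subset_Ioc_self
  · have := integrable_testFun_smul g hφ.continuous hc
    refine this.congr ((extendZero_ae_eq g).mono fun x hx => ?_)
    simp only [Complex.real_smul, hx]

theorem isWeakDeriv_of_primitive {a b : ℝ} (hab : a < b) {f g : L2Space a b} {G : ℝ → ℂ}
    (hG : ∀ x, G x = G a + ∫ t in a..x, extendZero g t)
    (hf : f =ᵐ[volume.restrict (Ioo a b)] G) : IsWeakDeriv f g := by
  intro φ hφ hc hs
  rw [← integral_deriv_smul_eq hab g hG hφ hc hs]
  exact integral_congr_ae (hf.mono fun x hx => by simp only [hx])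

/-- The difference of `f` and a primitive of `g` is orthogonal to derivatives of test functions, so
du Bois-Reymond makes it constant. -/
theorem IsWeakDeriv.exists_primitive {a b : ℝ} (hab : a < b) {f g : L2Space a b}
    (h : IsWeakDeriv f g) : ∃ G : ℝ → ℂ, (∀ x, G x = G a + ∫ t in a..x, extendZero g t) ∧
      f =ᵐ[volume.restrict (Ioo a b)] G := by
  have hG0 : Continuous fun x => ∫ t in a..x, extendZero g t :=
    intervalIntegral.continuous_primitive
      (fun _ _ => (integrable_extendZero g).intervalIntegrable) a
  have hG0i : IntegrableOn (fun x => ∫ t in a..x, extendZero g t) (Ioo a b) :=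
    (hG0.intervalIntegrable a b).1.mono_set Ioo_subset_Ioc_self
  have hfi : IntegrableOn f (Ioo a b) := (Lp.memLp f).integrable (by norm_num)
  obtain ⟨c, hc⟩ := ae_eq_const_of_integral_deriv_smul_eq_zero hab
    (h := fun x => f x - ∫ t in a..x, extendZero g t) (hfi.sub hG0i) (by
      intro φ hφ hc hs
      have hd : Continuous (deriv φ) := hφ.continuous_deriv (by simp)
      simp only [smul_sub]
      obtain ⟨C, hC⟩ := hc.deriv.exists_bound_of_continuous hd
      have hi : Integrable (fun x => deriv φ x • ∫ t in a..x, extendZero g t)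
          (volume.restrict (Ioo a b)) :=
        hG0i.bdd_smul C hd.aestronglyMeasurable (Filter.Eventually.of_forall hC)
      rw [integral_sub (integrable_testFun_smul f hd hc.deriv) hi,
        h φ hφ hc hs, integral_deriv_smul_eq hab g (by simp) hφ hc hs, sub_self])
  refine ⟨fun x => c + ∫ t in a..x, extendZero g t, fun x => by simp, hc.mono fun x hx => ?_⟩
  exact sub_eq_iff_eq_add.1 hx

/-- Localized to `[a, b]` because the derivative of a classical representative is a primitive of
`u''` only there. -/
theorem integral_product_rule_of_mem {E E' G h : ℝ → ℂ} {a b : ℝ}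
    (hE : ∀ x, HasDerivAt E (E' x) x) (hE' : Continuous E') (hh : Integrable h)
    (hG : ∀ x ∈ uIcc a b, G x = G a + ∫ t in a..x, h t) :
    ∫ x in a..b, (E' x * G x + E x * h x) = E b * G b - E a * G a := by
  have := integral_product_rule (G := fun x => G a + ∫ t in a..x, h t) (a := a) (b := b)
    hE hE' hh (by simp)
  rw [← hG b (by simp), ← hG a (by simp)] at this
  rw [← this]
  exact intervalIntegral.integral_congr fun x hx => by simp only [hG x hx]

/-! ### Classical representatives of Sobolev functions. -/

/-- `U` is a continuously differentiable representative of the Sobolev function `u`, with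
derivative `U'` representing `u'`. -/
structure IsClassicalRep {a b : ℝ} (u : SobolevSpace 2 a b) (U U' : ℝ → ℂ) : Prop where
  hasDerivAt : ∀ x, HasDerivAt U (U' x) x
  continuous_deriv : Continuous U'
  primitive : ∀ x ∈ Icc a b, U' x = U' a + ∫ t in a..x, extendZero (u.1 2) t
  ae_eq : u.1 0 =ᵐ[volume.restrict (Ioo a b)] U
  ae_eq_deriv : u.1 1 =ᵐ[volume.restrict (Ioo a b)] U'

namespace IsClassicalRep

variable {a b : ℝ} {u : SobolevSpace 2 a b} {U U' : ℝ → ℂ}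

theorem continuous (h : IsClassicalRep u U U') : Continuous U :=
  continuous_iff_continuousAt.2 fun x => (h.hasDerivAt x).continuousAt

theorem isContRep (h : IsClassicalRep u U U') : IsContRep (u.1 0) U :=
  ⟨h.continuous.continuousOn, h.ae_eq⟩

theorem isContRep_deriv (h : IsClassicalRep u U U') : IsContRep (u.1 1) U' :=
  ⟨h.continuous_deriv.continuousOn, h.ae_eq_deriv⟩

end IsClassicalRep

/-- Makes boundary values independent of the representative: continuous functions equal almost
everywhere on a nondegenerate interval coincide on it. -/
theorem IsContRep.eqOn {a b : ℝ} (hab : a < b) {f : L2Space a b} {F G : ℝ → ℂ}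
    (hF : IsContRep f F) (hG : IsContRep f G) : EqOn F G (Icc a b) := by
  refine Measure.eqOn_Icc_of_ae_eq volume hab.ne ?_ hF.1 hG.1
  rw [← restrict_Ioo_eq_restrict_Icc]
  exact hF.2.symm.trans hG.2

theorem SobolevSpace.exists_isClassicalRep {a b : ℝ} (hab : a < b) (u : SobolevSpace 2 a b) :
    ∃ U U' : ℝ → ℂ, IsClassicalRep u U U' := by
  obtain ⟨G, hG, hG'⟩ := IsWeakDeriv.exists_primitive hab (u.2 1)
  obtain ⟨F, hF, hF'⟩ := IsWeakDeriv.exists_primitive hab (u.2 0)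
  have hGc : Continuous G := by
    rw [funext hG]
    exact continuous_const.add (intervalIntegral.continuous_primitive
      (fun _ _ => (integrable_extendZero _).intervalIntegrable) a)
  -- Integrating the continuous `G`, not the zero extension of `u'`, makes the representative
  -- differentiable at every point, endpoints included.
  refine ⟨fun x => F a + ∫ t in a..x, G t, G, fun x => ?_, hGc, fun x _ => hG x, ?_, hG'⟩
  · exact (intervalIntegral.integral_hasDerivAt_right (hGc.intervalIntegrable _ _)
      hGc.stronglyMeasurable.stronglyMeasurableAtFilter hGc.continuousAt).const_add _
  · refine hF'.trans ((ae_restrict_iff' measurableSet_Ioo).2 (Filter.Eventually.of_forall ?_))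
    intro x hx
    rw [hF x]
    congr 1
    rw [intervalIntegral_eq_setIntegral_Ioo hx.1.le, intervalIntegral_eq_setIntegral_Ioo hx.1.le]
    refine integral_congr_ae (ae_restrict_of_ae_restrict_of_subset
      (Ioo_subset_Ioo_right hx.2.le) ?_)
    exact (extendZero_ae_eq _).symm.trans hG'

theorem memLp_two_of_continuous {a b : ℝ} {U : ℝ → ℂ} (hU : Continuous U) :
    MemLp U 2 (volume.restrict (Ioo a b)) := by
  obtain ⟨C, hC⟩ := (isCompact_Icc (a := a) (b := b)).exists_bound_of_continuousOn hU.continuousOn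
  exact MemLp.of_bound hU.aestronglyMeasurable C ((ae_restrict_iff' measurableSet_Ioo).2
    (Filter.Eventually.of_forall fun x hx => hC x (Ioo_subset_Icc_self hx)))

/-- A function with an absolutely continuous derivative is in the Sobolev space as soon as its
second derivative is square integrable. -/
theorem exists_sobolev_of_primitive {a b : ℝ} (hab : a < b) {U U' : ℝ → ℂ}
    (hU : ∀ x, HasDerivAt U (U' x) x) (hU' : Continuous U') (w : L2Space a b)
    (hw : ∀ x ∈ Icc a b, U' x = U' a + ∫ t in a..x, extendZero w t) :
    ∃ u : SobolevSpace 2 a b, IsClassicalRep u U U' ∧ u.1 2 = w := by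
  have hUc : Continuous U := continuous_iff_continuousAt.2 fun x => (hU x).continuousAt
  set f₀ : L2Space a b := (memLp_two_of_continuous hUc).toLp U
  set f₁ : L2Space a b := (memLp_two_of_continuous hU').toLp U'
  have h0 : f₀ =ᵐ[volume.restrict (Ioo a b)] U := MemLp.coeFn_toLp _
  have h1 : f₁ =ᵐ[volume.restrict (Ioo a b)] U' := MemLp.coeFn_toLp _
  have w12 : IsWeakDeriv f₁ w := by
    refine isWeakDeriv_of_primitive hab (G := fun x => U' a + ∫ t in a..x, extendZero w t)
      (by simp) (h1.trans ?_)
    exact (ae_restrict_iff' measurableSet_Ioo).2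
      (Filter.Eventually.of_forall fun x hx => hw x (Ioo_subset_Icc_self hx))
  have w01 : IsWeakDeriv f₀ f₁ := by
    refine isWeakDeriv_of_primitive hab (G := fun x => U a + ∫ t in a..x, extendZero f₁ t)
      (by simp) (h0.trans ?_)
    refine (ae_restrict_iff' measurableSet_Ioo).2 (Filter.Eventually.of_forall fun x hx => ?_)
    have e : ∫ t in a..x, extendZero f₁ t = ∫ t in a..x, U' t := by
      rw [intervalIntegral_eq_setIntegral_Ioo hx.1.le, intervalIntegral_eq_setIntegral_Ioo hx.1.le]
      refine integral_congr_ae (ae_restrict_of_ae_restrict_of_subset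
        (Ioo_subset_Ioo_right hx.2.le) ?_)
      exact (extendZero_ae_eq _).symm.trans h1
    simp only [e]
    rw [intervalIntegral.integral_eq_sub_of_hasDerivAt (fun x _ => hU x)
      (hU'.intervalIntegrable _ _)]
    ring
  refine ⟨⟨WithLp.toLp 2 ![f₀, f₁, w], ?_⟩, ⟨hU, hU', hw, h0, h1⟩, rfl⟩
  intro k
  fin_cases k
  · exact w01
  · exact w12

/-! ### Green's formula and the trace inequality. -/

namespace IsClassicalRep

variable {a b : ℝ} {u v : SobolevSpace 2 a b} {U U' V V' : ℝ → ℂ}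

theorem inner_eq_integral {f g : L2Space a b} {F G : ℝ → ℂ}
    (hf : f =ᵐ[volume.restrict (Ioo a b)] F) (hg : g =ᵐ[volume.restrict (Ioo a b)] G) :
    inner ℂ f g = ∫ x in Ioo a b, (starRingEnd ℂ) (F x) * G x := by
  rw [L2.inner_def]
  refine integral_congr_ae ?_
  filter_upwards [hf, hg] with x h1 h2
  rw [h1, h2, RCLike.inner_apply, mul_comm]

/-- The product rule for `conj U` and the absolutely continuous `U'`. -/
theorem green (hab : a < b) (h : IsClassicalRep u U U') :
    inner ℂ (u.1 1) (u.1 1) + inner ℂ (u.1 0) (u.1 2) =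
      (starRingEnd ℂ) (U b) * U' b - (starRingEnd ℂ) (U a) * U' a := by
  have h1 := integral_product_rule_of_mem (a := a) (b := b)
    (E := fun x => (starRingEnd ℂ) (U x)) (E' := fun x => (starRingEnd ℂ) (U' x)) (G := U')
    (fun x => (h.hasDerivAt x).star) (Complex.continuous_conj.comp h.continuous_deriv)
    (integrable_extendZero (u.1 2)) (by rw [uIcc_of_le hab.le]; exact h.primitive)
  rw [← h1, inner_eq_integral h.ae_eq_deriv h.ae_eq_deriv,
    inner_eq_integral h.ae_eq (extendZero_ae_eq _), ← intervalIntegral_eq_setIntegral_Ioo hab.le,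
    ← intervalIntegral_eq_setIntegral_Ioo hab.le, intervalIntegral.integral_add]
  · exact ((Complex.continuous_conj.comp h.continuous_deriv).mul
      h.continuous_deriv).intervalIntegrable _ _
  · exact ((integrable_extendZero (u.1 2)).intervalIntegrable).continuousOn_mul
      (Complex.continuous_conj.comp h.continuous).continuousOn

theorem norm_sq_eq_integral (hab : a < b) {f : L2Space a b} {F : ℝ → ℂ}
    (hf : f =ᵐ[volume.restrict (Ioo a b)] F) : ‖f‖ ^ 2 = ∫ x in a..b, ‖F x‖ ^ 2 := by
  have h1 := inner_eq_integral hf hf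
  rw [inner_self_eq_norm_sq_to_K, intervalIntegral_eq_setIntegral_Ioo hab.le] at *
  have : ∀ x, (starRingEnd ℂ) (F x) * F x = ((‖F x‖ ^ 2 : ℝ) : ℂ) := fun x => by
    rw [mul_comm, Complex.mul_conj, Complex.normSq_eq_norm_sq]
  simp only [this] at h1
  rw [integral_complex_ofReal] at h1
  exact Complex.ofReal_injective ((Complex.ofReal_pow _ _).trans h1)

/-- The trace inequality. -/
theorem norm_sq_le (hab : a < b) (h : IsClassicalRep u U U') {t : ℝ} (ht : 0 < t) {x : ℝ}
    (hx : x ∈ Icc a b) : (b - a) * ‖U x‖ ^ 2 ≤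
      (1 + (b - a) * t) * ‖u.1 0‖ ^ 2 + (b - a) * t⁻¹ * ‖u.1 1‖ ^ 2 := by
  have hc := h.continuous
  have hc' := h.continuous_deriv
  have c1 : Continuous fun y => t * ‖U y‖ ^ 2 + t⁻¹ * ‖U' y‖ ^ 2 := by fun_prop
  have c2 : Continuous fun y => 2 * inner ℝ (U y) (U' y) := by fun_prop
  set K := ∫ y in a..b, (t * ‖U y‖ ^ 2 + t⁻¹ * ‖U' y‖ ^ 2) with hK
  have hK' : K = t * ‖u.1 0‖ ^ 2 + t⁻¹ * ‖u.1 1‖ ^ 2 := by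
    rw [hK, intervalIntegral.integral_add, intervalIntegral.integral_const_mul,
      intervalIntegral.integral_const_mul, norm_sq_eq_integral hab h.ae_eq,
      norm_sq_eq_integral hab h.ae_eq_deriv]
    · exact Continuous.intervalIntegrable (by fun_prop) _ _
    · exact Continuous.intervalIntegrable (by fun_prop) _ _
  -- Young's inequality with weight `t` for the derivative of `‖U‖²`.
  have hb : ∀ y, ‖2 * inner ℝ (U y) (U' y)‖ ≤ t * ‖U y‖ ^ 2 + t⁻¹ * ‖U' y‖ ^ 2 := by
    intro y
    have h1 := abs_real_inner_le_norm (U y) (U' y)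
    rw [Real.norm_eq_abs, abs_mul, abs_two]
    have h2 : 0 ≤ t⁻¹ * (t * ‖U y‖ - ‖U' y‖) ^ 2 := by positivity
    have h3 : t⁻¹ * (t * ‖U y‖ - ‖U' y‖) ^ 2 =
        t * ‖U y‖ ^ 2 + t⁻¹ * ‖U' y‖ ^ 2 - 2 * (‖U y‖ * ‖U' y‖) := by
      field_simp
      ring
    linarith
  have key : ∀ y ∈ Icc a b, ‖U x‖ ^ 2 ≤ ‖U y‖ ^ 2 + K := by
    intro y hy
    have e := intervalIntegral.integral_eq_sub_of_hasDerivAt (a := y) (b := x)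
      (fun s _ => (h.hasDerivAt s).norm_sq) (c2.intervalIntegrable _ _)
    have h1 : ‖∫ s in y..x, 2 * inner ℝ (U s) (U' s)‖ ≤ K := by
      refine (intervalIntegral.norm_integral_le_integral_norm_uIoc).trans ?_
      refine (setIntegral_mono_on (c2.norm.integrableOn_uIoc) c1.integrableOn_uIoc
        measurableSet_uIoc fun s _ => hb s).trans ?_
      rw [hK, intervalIntegral.integral_of_le hab.le]
      refine setIntegral_mono_set (c1.integrableOn_Ioc)
        (Filter.Eventually.of_forall fun s => by positivity) (Filter.Eventually.of_forall ?_)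
      intro s hs
      rcases mem_uIoc.1 hs with h | h
      · exact ⟨hy.1.trans_lt h.1, h.2.trans hx.2⟩
      · exact ⟨hx.1.trans_lt h.1, h.2.trans hy.2⟩
    have := (le_abs_self _).trans h1
    rw [e] at this
    linarith
  -- Averaging over `y` replaces the pointwise value `‖U y‖²` by the `L₂` norm.
  have h2 : ∫ y in a..b, ‖U x‖ ^ 2 ≤ ∫ y in a..b, (‖U y‖ ^ 2 + K) :=
    intervalIntegral.integral_mono_on hab.le (by simp)
      (Continuous.intervalIntegrable (by fun_prop) _ _) key
  rw [intervalIntegral.integral_const, intervalIntegral.integral_add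
    (Continuous.intervalIntegrable (by fun_prop) _ _) (by simp), intervalIntegral.integral_const,
    ← norm_sq_eq_integral hab h.ae_eq, hK', smul_eq_mul, smul_eq_mul] at h2
  linarith

theorem add (hu : IsClassicalRep u U U') (hv : IsClassicalRep v V V') :
    IsClassicalRep (u + v) (U + V) (U' + V') := by
  refine ⟨fun x => (hu.hasDerivAt x).add (hv.hasDerivAt x),
    hu.continuous_deriv.add hv.continuous_deriv, fun x hx => ?_,
    (Lp.coeFn_add _ _).trans (hu.ae_eq.add hv.ae_eq),
    (Lp.coeFn_add _ _).trans (hu.ae_eq_deriv.add hv.ae_eq_deriv)⟩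
  have e : ∫ t in a..x, extendZero ((u + v).1 2) t =
      ∫ t in a..x, (extendZero (u.1 2) t + extendZero (v.1 2) t) := by
    rw [intervalIntegral_eq_setIntegral_Ioo hx.1, intervalIntegral_eq_setIntegral_Ioo hx.1]
    refine integral_congr_ae (ae_restrict_of_ae_restrict_of_subset (Ioo_subset_Ioo_right hx.2) ?_)
    have h3 : ((u + v).1 2 : ℝ → ℂ) =ᵐ[volume.restrict (Ioo a b)] fun x => u.1 2 x + v.1 2 x :=
      Lp.coeFn_add _ _
    filter_upwards [extendZero_ae_eq (u.1 2), extendZero_ae_eq (v.1 2),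
      extendZero_ae_eq ((u + v).1 2), h3] with y h1 h2 h3 h4
    rw [← h1, ← h2, ← h3, h4]
  rw [e, intervalIntegral.integral_add (integrable_extendZero _).intervalIntegrable
    (integrable_extendZero _).intervalIntegrable, Pi.add_apply, Pi.add_apply, hu.primitive x hx,
    hv.primitive x hx]
  ring

end IsClassicalRep

/-! ### Solutions of the differential equation on one interval. -/

/-- A particular solution of `κ² u - u'' = g`. -/
theorem exists_particular_solution {a b : ℝ} (hab : a < b) {κ : ℂ} (hκ : κ ≠ 0)
    (g : L2Space a b) : ∃ (u : SobolevSpace 2 a b), κ ^ 2 • u.1 0 - u.1 2 = g := by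
  have hexp : ∀ k : ℂ, ∀ x : ℝ,
      HasDerivAt (fun y : ℝ => Complex.exp (k * y)) (k * Complex.exp (k * x)) x := by
    intro k x
    have := ((Complex.ofRealCLM.hasDerivAt (x := x)).const_mul k).cexp
    simpa [mul_comm] using this
  have hexpc : ∀ k : ℂ, Continuous fun y : ℝ => Complex.exp (k * y) := fun k => by fun_prop
  have hint : ∀ k m : ℂ, Integrable fun t : ℝ => m * (Complex.exp (k * t) * extendZero g t) := by
    intro k m
    have : Integrable fun t : ℝ => Complex.exp (k * t) * extendZero g t := by
      have h1 : IntegrableOn (fun t : ℝ => Complex.exp (k * t) * extendZero g t) (Icc a b) :=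
        (integrable_extendZero g).integrableOn.continuousOn_mul (hexpc k).continuousOn
          isCompact_Icc
      refine (integrableOn_iff_integrable_of_support_subset fun x hx => ?_).1 h1
      by_contra hx'
      refine hx ?_
      simp only [extendZero]
      rw [indicator_of_notMem (fun h => hx' (Ioo_subset_Icc_self h)), mul_zero]
    exact this.const_mul m
  -- Variation of constants: `P` and `Q` are the coefficients of `exp (κ x)` and `exp (-κ x)`, and
  -- `2 κ` comes from their Wronskian.
  set P : ℝ → ℂ := fun x => ∫ t in a..x, -(2 * κ)⁻¹ * (Complex.exp (-κ * t) * extendZero g t)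
  set Q : ℝ → ℂ := fun x => ∫ t in a..x, (2 * κ)⁻¹ * (Complex.exp (κ * t) * extendZero g t)
  have hPc : Continuous P := intervalIntegral.continuous_primitive
    (fun _ _ => (hint _ _).intervalIntegrable) a
  have hQc : Continuous Q := intervalIntegral.continuous_primitive
    (fun _ _ => (hint _ _).intervalIntegrable) a
  -- Each product is written as the integral of its almost everywhere derivative. In the sum the
  -- terms with `g` cancel, so `U` is continuously differentiable; in the difference they add up and
  -- produce `U'' = κ² U - g`.
  have rP : ∀ x, ∫ t in a..x, (κ * Complex.exp (κ * t) * P t - (2 * κ)⁻¹ * extendZero g t) =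
      Complex.exp (κ * x) * P x := by
    intro x
    have h1 := integral_product_rule (a := a) (b := x) (G := P) (hexp κ)
      (continuous_const.mul (hexpc κ)) (hint (-κ) (-(2 * κ)⁻¹)) (by simp [P])
    have hPa : P a = 0 := by simp [P]
    rw [hPa, mul_zero, sub_zero] at h1
    rw [← h1]
    refine intervalIntegral.integral_congr fun t _ => ?_
    have : Complex.exp (κ * t) * Complex.exp (-κ * t) = 1 := by
      rw [← Complex.exp_add]; simp
    linear_combination ((2 * κ)⁻¹ * extendZero g t) * this
  have rQ : ∀ x, ∫ t in a..x, (-κ * Complex.exp (-κ * t) * Q t + (2 * κ)⁻¹ * extendZero g t) =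
      Complex.exp (-κ * x) * Q x := by
    intro x
    have h1 := integral_product_rule (a := a) (b := x) (G := Q) (hexp (-κ))
      (continuous_const.mul (hexpc (-κ))) (hint κ ((2 * κ)⁻¹)) (by simp [Q])
    have hQa : Q a = 0 := by simp [Q]
    rw [hQa, mul_zero, sub_zero] at h1
    rw [← h1]
    refine intervalIntegral.integral_congr fun t _ => ?_
    have : Complex.exp (κ * t) * Complex.exp (-κ * t) = 1 := by
      rw [← Complex.exp_add]; simp
    linear_combination (-(2 * κ)⁻¹ * extendZero g t) * this
  have gi : ∀ x, IntervalIntegrable (fun t => (2 * κ)⁻¹ * extendZero g t) volume a x := fun x =>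
    ((integrable_extendZero g).const_mul _).intervalIntegrable
  have iP : ∀ x, IntervalIntegrable (fun t : ℝ => κ * Complex.exp (κ * t) * P t -
      (2 * κ)⁻¹ * extendZero g t) volume a x := fun x =>
    (Continuous.intervalIntegrable (by fun_prop) _ _).sub (gi x)
  have iQ : ∀ x, IntervalIntegrable (fun t : ℝ => -κ * Complex.exp (-κ * t) * Q t +
      (2 * κ)⁻¹ * extendZero g t) volume a x := fun x =>
    (Continuous.intervalIntegrable (by fun_prop) _ _).add (gi x)
  set U : ℝ → ℂ := fun x => Complex.exp (κ * x) * P x + Complex.exp (-κ * x) * Q x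
  set U' : ℝ → ℂ := fun x => κ * (Complex.exp (κ * x) * P x - Complex.exp (-κ * x) * Q x)
  have hUc : Continuous U := by fun_prop
  have hU'c : Continuous U' := by fun_prop
  have hU : ∀ x, HasDerivAt U (U' x) x := by
    have e : U = fun x => ∫ t in a..x, U' t := by
      funext x
      simp only [U]
      rw [← rP x, ← rQ x, ← intervalIntegral.integral_add (iP x) (iQ x)]
      refine intervalIntegral.integral_congr fun t _ => ?_
      simp only [U']
      ring
    intro x
    rw [e]
    exact intervalIntegral.integral_hasDerivAt_right (hU'c.intervalIntegrable _ _)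
      hU'c.stronglyMeasurable.stronglyMeasurableAtFilter hU'c.continuousAt
  set f₀ : L2Space a b := (memLp_two_of_continuous hUc).toLp U
  have h0 : f₀ =ᵐ[volume.restrict (Ioo a b)] U := MemLp.coeFn_toLp _
  obtain ⟨u, hu, hu2⟩ := exists_sobolev_of_primitive hab hU hU'c (κ ^ 2 • f₀ - g) (by
    intro x hx
    have hUa : U' a = 0 := by simp [U', P, Q]
    rw [hUa, zero_add]
    simp only [U']
    rw [← rP x, ← rQ x, ← intervalIntegral.integral_sub (iP x) (iQ x),
      ← intervalIntegral.integral_const_mul, intervalIntegral_eq_setIntegral_Ioo hx.1,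
      intervalIntegral_eq_setIntegral_Ioo hx.1]
    refine integral_congr_ae (ae_restrict_of_ae_restrict_of_subset (Ioo_subset_Ioo_right hx.2) ?_)
    filter_upwards [extendZero_ae_eq g, extendZero_ae_eq (κ ^ 2 • f₀ - g), h0,
      Lp.coeFn_sub (κ ^ 2 • f₀) g, Lp.coeFn_smul (κ ^ 2) f₀] with y h1 h2 h3 h4 h5
    rw [← h2, h4, Pi.sub_apply, h5, Pi.smul_apply, h3, ← h1, smul_eq_mul]
    simp only [U]
    field_simp
    ring)
  refine ⟨u, ?_⟩
  have : u.1 0 = f₀ := Lp.ext (hu.ae_eq.trans h0.symm)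
  rw [hu2, this, sub_sub_cancel]

/-- The solutions `x ↦ c₁ exp (κ x) + c₂ exp (-κ x)` of `κ² u - u'' = 0`. -/
theorem exists_homogeneous_solution {a b : ℝ} (hab : a < b) (κ c₁ c₂ : ℂ) :
    ∃ (u : SobolevSpace 2 a b), κ ^ 2 • u.1 0 - u.1 2 = 0 ∧ IsClassicalRep u
      (fun x => c₁ * Complex.exp (κ * x) + c₂ * Complex.exp (-κ * x))
      (fun x => κ * (c₁ * Complex.exp (κ * x) - c₂ * Complex.exp (-κ * x))) := by
  have hexp : ∀ k : ℂ, ∀ x : ℝ,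
      HasDerivAt (fun y : ℝ => Complex.exp (k * y)) (k * Complex.exp (k * x)) x := by
    intro k x
    have := ((Complex.ofRealCLM.hasDerivAt (x := x)).const_mul k).cexp
    simpa [mul_comm] using this
  have hUc : Continuous fun x : ℝ =>
    c₁ * Complex.exp (κ * x) + c₂ * Complex.exp (-κ * x) := by fun_prop
  set f₀ : L2Space a b := (memLp_two_of_continuous hUc).toLp _ with hf₀
  have h0 : f₀ =ᵐ[volume.restrict (Ioo a b)] _ := MemLp.coeFn_toLp (memLp_two_of_continuous hUc)
  obtain ⟨u, hu, hu2⟩ := exists_sobolev_of_primitive hab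
    (U := fun x => c₁ * Complex.exp (κ * x) + c₂ * Complex.exp (-κ * x))
    (U' := fun x => κ * (c₁ * Complex.exp (κ * x) - c₂ * Complex.exp (-κ * x)))
    (fun x => by
      refine (((hexp κ x).const_mul c₁).add ((hexp (-κ) x).const_mul c₂)).congr_deriv ?_
      ring) (by fun_prop) (κ ^ 2 • f₀) (fun x hx => by
      have e : ∫ t in a..x, extendZero (κ ^ 2 • f₀) t =
          ∫ t in a..x, κ ^ 2 * (c₁ * Complex.exp (κ * t) + c₂ * Complex.exp (-κ * t)) := by
        rw [intervalIntegral_eq_setIntegral_Ioo hx.1, intervalIntegral_eq_setIntegral_Ioo hx.1]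
        refine integral_congr_ae (ae_restrict_of_ae_restrict_of_subset
          (Ioo_subset_Ioo_right hx.2) ?_)
        filter_upwards [extendZero_ae_eq (κ ^ 2 • f₀), h0, Lp.coeFn_smul (κ ^ 2) f₀]
          with y h1 h2 h3
        rw [← h1, h3, Pi.smul_apply, h2, smul_eq_mul]
      rw [e, intervalIntegral.integral_eq_sub_of_hasDerivAt
        (f := fun x : ℝ => κ * (c₁ * Complex.exp (κ * x) - c₂ * Complex.exp (-κ * x)))
        (fun x _ => ((((hexp κ x).const_mul c₁).sub
          ((hexp (-κ) x).const_mul c₂)).const_mul κ).congr_deriv (by ring))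
        (Continuous.intervalIntegrable (by fun_prop) _ _)]
      ring)
  refine ⟨u, ?_, hu⟩
  have : u.1 0 = f₀ := Lp.ext (hu.ae_eq.trans h0.symm)
  rw [hu2, this, sub_self]

/-! ### Relative smallness of compact operators. -/

/-- Ehrling's inequality for a compact operator and an injective bounded operator. -/
theorem IsCompactOperator.exists_norm_le_add {H K : Type*} [NormedAddCommGroup H]
    [InnerProductSpace ℂ H] [CompleteSpace H] [NormedAddCommGroup K] [InnerProductSpace ℂ K]
    [CompleteSpace K] {A : H →ₗ[ℂ] K} (hA : IsCompactOperator A) {J : H →L[ℂ] K}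
    (hJ : Function.Injective J) {η : ℝ} (hη : 0 < η) :
    ∃ C : ℝ, 0 ≤ C ∧ ∀ u, ‖A u‖ ≤ η * ‖u‖ + C * ‖J u‖ := by
  let T : H →L[ℂ] K := ⟨A, hA.continuous⟩
  have hT : ∀ u, T u = A u := fun _ => rfl
  obtain ⟨S, hS, hAS⟩ := hA.image_closedBall_subset_compact 1
  obtain ⟨t, ht, htS⟩ := Metric.totallyBounded_iff.1 hS.totallyBounded (η / 2) (by positivity)
  -- Injectivity of `J` amounts to density of the range of its adjoint.
  have hdense : (J.adjoint.toLinearMap.range).topologicalClosure = ⊤ := by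
    rw [Submodule.topologicalClosure_eq_top_iff, ContinuousLinearMap.orthogonal_range,
      ContinuousLinearMap.adjoint_adjoint]
    exact LinearMap.ker_eq_bot.2 hJ
  -- For a fixed `y`, approximating `T* y` by `J* z` makes `⟨y, A u⟩` small whenever `u` is bounded
  -- and `J u` is small.
  have hy : ∀ y : K, ∀ᶠ r in nhdsWithin (0 : ℝ) (Ioi 0), ∀ u : H, ‖u‖ ≤ 1 → ‖J u‖ < r →
      ‖inner ℂ y (A u)‖ ≤ η ^ 2 / 2 := by
    intro y
    have hmem : T.adjoint y ∈ closure (J.adjoint.toLinearMap.range : Set H) := by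
      rw [← Submodule.topologicalClosure_coe, hdense]
      trivial
    obtain ⟨w, ⟨z, rfl⟩, hw⟩ := Metric.mem_closure_iff.1 hmem (η ^ 2 / 4) (by positivity)
    rw [dist_eq_norm] at hw
    have hlim : Filter.Tendsto (fun r : ℝ => ‖z‖ * r) (nhdsWithin 0 (Ioi 0)) (nhds 0) := by
      have : Filter.Tendsto (fun r : ℝ => ‖z‖ * r) (nhds 0) (nhds (‖z‖ * 0)) :=
        (continuous_const.mul continuous_id).tendsto 0
      rw [mul_zero] at this
      exact this.mono_left nhdsWithin_le_nhds
    filter_upwards [hlim.eventually (gt_mem_nhds (show 0 < η ^ 2 / 4 by positivity))]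
      with r hr u hu hJu
    have e : inner ℂ y (A u) = inner ℂ (T.adjoint y - J.adjoint z) u + inner ℂ z (J u) := by
      rw [inner_sub_left, ContinuousLinearMap.adjoint_inner_left,
        ContinuousLinearMap.adjoint_inner_left, hT]
      ring
    rw [e]
    calc _ ≤ ‖T.adjoint y - J.adjoint z‖ * ‖u‖ + ‖z‖ * ‖J u‖ :=
          (norm_add_le _ _).trans (add_le_add (norm_inner_le_norm _ _) (norm_inner_le_norm _ _))
      _ ≤ η ^ 2 / 4 * 1 + ‖z‖ * r := by
          gcongr
          exact hw.le
      _ ≤ η ^ 2 / 2 := by linarith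
  -- The net `t` of the compact image is finite, so one `r` serves all its points.
  have hall := (Filter.eventually_all_finite ht).2 fun y _ => hy y
  obtain ⟨r, hr, hr0⟩ := (hall.and self_mem_nhdsWithin).exists
  have hr0 : 0 < r := hr0
  have hunit : ∀ u : H, ‖u‖ ≤ 1 → ‖J u‖ < r → ‖A u‖ ≤ η := by
    intro u hu hJu
    obtain ⟨y, hyt, hyu⟩ := mem_iUnion₂.1 (htS (hAS ⟨u, by simpa using hu, rfl⟩))
    rw [Metric.mem_ball, dist_eq_norm] at hyu
    have h1 := hr y hyt u hu hJu
    have h2 : ‖A u‖ ^ 2 ≤ ‖A u - y‖ * ‖A u‖ + ‖inner ℂ y (A u)‖ := by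
      have e : inner ℂ (A u) (A u) = inner ℂ (A u - y) (A u) + inner ℂ y (A u) := by
        rw [inner_sub_left]; ring
      have h3 : ‖A u‖ ^ 2 = ‖inner ℂ (A u) (A u)‖ := by
        rw [inner_self_eq_norm_sq_to_K]; simp
      rw [h3, e]
      exact (norm_add_le _ _).trans (add_le_add_left (norm_inner_le_norm _ _) _)
    -- With `x = ‖A u‖ > η`, the bound `x² ≤ (η / 2) x + η² / 2` fails, since `x (x - η / 2) > η² /
    -- 2`.
    by_contra h
    push Not at h
    have h4 : ‖A u - y‖ * ‖A u‖ ≤ η / 2 * ‖A u‖ := by gcongr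
    nlinarith
  -- If `‖J u‖ ≥ r ‖u‖`, the second term alone dominates `‖T‖ ‖u‖`; otherwise `hunit` applies after
  -- normalization.
  refine ⟨‖T‖ / r, by positivity, fun u => ?_⟩
  rcases eq_or_ne u 0 with rfl | hu
  · simp
  have hn : 0 < ‖u‖ := norm_pos_iff.2 hu
  by_cases hJu : ‖J u‖ < r * ‖u‖
  · have h1 := hunit (((‖u‖⁻¹ : ℝ) : ℂ) • u) (by simp [norm_smul, hn.ne']) (by
      rw [map_smul, norm_smul, Complex.norm_real, norm_inv, norm_norm, inv_mul_lt_iff₀ hn,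
        mul_comm]
      exact hJu)
    rw [map_smul, norm_smul, Complex.norm_real, norm_inv, norm_norm, inv_mul_le_iff₀ hn] at h1
    have : 0 ≤ ‖T‖ / r * ‖J u‖ := by positivity
    linarith
  · push Not at hJu
    have h1 := T.le_opNorm u
    rw [hT] at h1
    have h2 : ‖T‖ / r * (r * ‖u‖) ≤ ‖T‖ / r * ‖J u‖ := by gcongr
    have h3 : ‖T‖ / r * (r * ‖u‖) = ‖T‖ * ‖u‖ := by field_simp
    have : 0 ≤ η * ‖u‖ := by positivity
    linarith

/-- Expresses the pairing with a test function as a continuous functional on `L₂`, so that weak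
differentiability is a closed condition. -/
theorem exists_inner_eq_integral_testFun {a b : ℝ} {φ : ℝ → ℝ} (hc : Continuous φ) :
    ∃ p : L2Space a b, ∀ f : L2Space a b, ∫ x in Ioo a b, φ x • f x = inner ℂ p f := by
  have hφ : Continuous fun x => (φ x : ℂ) := Complex.continuous_ofReal.comp hc
  refine ⟨(memLp_two_of_continuous hφ).toLp _, fun f => ?_⟩
  rw [IsClassicalRep.inner_eq_integral (MemLp.coeFn_toLp (memLp_two_of_continuous hφ))
    (Filter.EventuallyEq.refl _ f)]
  simp

theorem SobolevSpace.isClosed (n : ℕ) (a b : ℝ) :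
    IsClosed (SobolevSpace n a b : Set (PiLp 2 (fun _ : Fin (n + 1) => L2Space a b))) := by
  have : (SobolevSpace n a b : Set (PiLp 2 (fun _ : Fin (n + 1) => L2Space a b))) =
      ⋂ k : Fin n, {u | IsWeakDeriv (u k.castSucc) (u k.succ)} := by
    ext u
    simp only [mem_iInter]
    rfl
  rw [this]
  refine isClosed_iInter fun k => ?_
  simp only [IsWeakDeriv, ofPred_forall]
  refine isClosed_iInter fun φ => isClosed_iInter fun hφ => isClosed_iInter fun hc =>
    isClosed_iInter fun hs => ?_
  obtain ⟨p, hp⟩ := exists_inner_eq_integral_testFun (a := a) (b := b)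
    (hφ.continuous_deriv (by simp))
  obtain ⟨q, hq⟩ := exists_inner_eq_integral_testFun (a := a) (b := b) hφ.continuous
  simp only [hp, hq]
  refine isClosed_eq ?_ ?_
  · exact continuous_const.inner (PiLp.continuous_apply 2 _ _)
  · exact (continuous_const.inner (PiLp.continuous_apply 2 _ _)).neg

/-- Supplies the completeness that the adjoints in Ehrling's inequality require. -/
instance SobolevSpace.completeSpace (n : ℕ) (a b : ℝ) : CompleteSpace (SobolevSpace n a b) :=
  (SobolevSpace.isClosed n a b).completeSpace_coe

theorem W22Sum.norm_sq (u : W22Sum) : ‖u‖ ^ 2 =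
    (‖u.fst.1 0‖ ^ 2 + ‖u.fst.1 1‖ ^ 2 + ‖u.fst.1 2‖ ^ 2) +
      (‖u.snd.1 0‖ ^ 2 + ‖u.snd.1 1‖ ^ 2 + ‖u.snd.1 2‖ ^ 2) := by
  rw [WithLp.prod_norm_sq_eq_of_L2, ← Submodule.norm_coe u.fst, ← Submodule.norm_coe u.snd,
    PiLp.norm_sq_eq_of_L2, PiLp.norm_sq_eq_of_L2, Fin.sum_univ_three, Fin.sum_univ_three]

theorem W22Sum.norm_toL2_sq (u : W22Sum) :
    ‖W22Sum.toL2 u‖ ^ 2 = ‖u.fst.1 0‖ ^ 2 + ‖u.snd.1 0‖ ^ 2 :=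
  WithLp.prod_norm_sq_eq_of_L2 _

theorem W22Sum.norm_toL2_le (u : W22Sum) : ‖W22Sum.toL2 u‖ ≤ ‖u‖ := by
  refine le_of_sq_le_sq ?_ (norm_nonneg _)
  rw [W22Sum.norm_toL2_sq, W22Sum.norm_sq]
  nlinarith [sq_nonneg ‖u.fst.1 1‖, sq_nonneg ‖u.fst.1 2‖, sq_nonneg ‖u.snd.1 1‖,
    sq_nonneg ‖u.snd.1 2‖]

/-- Relative boundedness with bound zero of a compact operator `W₂² → L₂`. -/
theorem W22Sum.exists_norm_le_add {A : W22Sum →ₗ[ℂ] L2Sum} (hA : IsCompactOperator A) {η : ℝ}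
    (hη : 0 < η) : ∃ C : ℝ, 0 ≤ C ∧ ∀ u, ‖A u‖ ≤ η * ‖u‖ + C * ‖W22Sum.toL2 u‖ :=
  hA.exists_norm_le_add
    (J := W22Sum.toL2.mkContinuous 1 fun u => by rw [one_mul]; exact W22Sum.norm_toL2_le u)
    W22Sum.toL2_injective hη

/-! ### Coercivity in the double sector. -/

/-- Points of a double sector around the imaginary axis. -/
theorem exists_mul_norm_le_abs_im {ε : ℝ} (hε : 0 < ε) : ∃ c : ℝ, 0 < c ∧
    ∀ z : ℂ, ε < |z.arg| → ε < |(-z).arg| → c * ‖z‖ ≤ |z.im| := by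
  by_cases hε' : ε < Real.pi / 2
  · refine ⟨Real.sin ε, Real.sin_pos_of_pos_of_lt_pi hε (by linarith [Real.pi_pos]), ?_⟩
    have key : ∀ z : ℂ, 0 ≤ z.im → ε < |z.arg| → ε < |(-z).arg| →
        Real.sin ε * ‖z‖ ≤ |z.im| := by
      intro z hz h1 h2
      have h0 : 0 ≤ z.arg := Complex.arg_nonneg_iff.2 hz
      have hlt : z.arg ≤ Real.pi - ε := by
        rcases hz.lt_or_eq with hpos | h
        · rw [Complex.arg_neg_eq_arg_sub_pi_of_im_pos hpos, abs_of_nonpos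
            (by linarith [Complex.arg_le_pi z])] at h2
          linarith
        · exfalso
          rcases le_or_gt 0 z.re with hre | hre
          · rw [Complex.arg_eq_zero_iff.2 ⟨hre, h.symm⟩, abs_zero] at h1
            linarith
          · rw [Complex.arg_eq_zero_iff.2 ⟨by simpa using hre.le, by simpa using h.symm⟩,
              abs_zero] at h2
            linarith
      rw [abs_of_nonneg h0] at h1
      rw [← Complex.norm_mul_sin_arg, abs_mul, abs_norm, mul_comm]
      refine mul_le_mul_of_nonneg_left (le_trans ?_ (le_abs_self _)) (norm_nonneg _)
      rcases le_or_gt z.arg (Real.pi / 2) with h | h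
      · exact Real.sin_le_sin_of_le_of_le_pi_div_two (by linarith) h h1.le
      · rw [← Real.sin_pi_sub z.arg]
        exact Real.sin_le_sin_of_le_of_le_pi_div_two (by linarith) (by linarith) (by linarith)
    intro z h1 h2
    rcases le_total 0 z.im with hz | hz
    · exact key z hz h1 h2
    · have := key (-z) (by simpa using hz) h2 (by simpa using h1)
      simpa using this
  -- For `ε ≥ π / 2` the sector is empty: both `z` and `-z` would have negative real part.
  · refine ⟨1, one_pos, fun z h1 h2 => ?_⟩
    exfalso
    push Not at hε'
    have h3 := mt Complex.abs_arg_le_pi_div_two_iff.2 (not_le.2 (hε'.trans_lt h1))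
    have h4 := mt Complex.abs_arg_le_pi_div_two_iff.2 (not_le.2 (hε'.trans_lt h2))
    simp only [Complex.neg_re] at h4
    linarith

/-- A coercivity estimate off the real axis. -/
theorem add_le_of_le_abs_im {c a b : ℝ} (hc : 0 < c) (ha : 0 ≤ a) {μ : ℂ}
    (hμ : c * ‖μ‖ ≤ |μ.im|) : ‖μ‖ * a + b ≤ (1 + 2 / c) * ‖μ * a + b‖ := by
  have h1 : |μ.im| * a ≤ ‖μ * a + b‖ := by
    have := Complex.abs_im_le_norm (μ * a + b)
    simpa [abs_mul, abs_of_nonneg ha] using this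
  have h2 : b - ‖μ‖ * a ≤ ‖μ * a + b‖ := by
    have h3 : ‖(b : ℂ)‖ ≤ ‖μ * a + b‖ + ‖μ * a‖ := by
      have := norm_sub_le (μ * a + b) (μ * a)
      rwa [add_sub_cancel_left] at this
    rw [norm_mul, Complex.norm_real, Complex.norm_real, Real.norm_of_nonneg ha] at h3
    linarith [le_abs_self b, Real.norm_eq_abs b]
  have h4 : ‖μ‖ * a ≤ ‖μ * a + b‖ / c := by
    rw [le_div_iff₀ hc]
    nlinarith
  -- The bound on `‖μ‖ a` enters twice, once for itself and once in the bound on `b`; hence `2 / c`.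
  have : (1 + 2 / c) * ‖μ * a + b‖ = ‖μ * a + b‖ + 2 * (‖μ * a + b‖ / c) := by ring
  linarith

/-! ### The a priori estimate under boundary and transmission conditions. -/

theorem mem_boundarySubmodule_iff {c : TransmissionData} {u : W22Sum} {U U' V V' : ℝ → ℂ}
    (hU : IsClassicalRep u.fst U U') (hV : IsClassicalRep u.snd V V') :
    u ∈ boundarySubmodule c ↔ c.α₀ * U (-1) + c.α₁ * U' (-1) = 0 ∧
      c.β₀ * V 1 + c.β₁ * V' 1 = 0 ∧ U' 0 - c.γ₀ * U 0 - c.δ₀ * V 0 = 0 ∧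
      V' 0 - c.γ₁ * U 0 - c.δ₁ * V 0 = 0 := by
  constructor
  · rintro ⟨X, X', Y, Y', h1, h2, h3, h4, e1, e2, e3, e4⟩
    have k1 := h1.eqOn (by norm_num) hU.isContRep
    have k2 := h2.eqOn (by norm_num) hU.isContRep_deriv
    have k3 := h3.eqOn (by norm_num) hV.isContRep
    have k4 := h4.eqOn (by norm_num) hV.isContRep_deriv
    have a1 : (-1 : ℝ) ∈ Icc (-1 : ℝ) 0 := by norm_num
    have a2 : (0 : ℝ) ∈ Icc (-1 : ℝ) 0 := by norm_num
    have a3 : (0 : ℝ) ∈ Icc (0 : ℝ) 1 := by norm_num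
    have a4 : (1 : ℝ) ∈ Icc (0 : ℝ) 1 := by norm_num
    rw [k1 a1, k2 a1] at e1
    rw [k3 a4, k4 a4] at e2
    rw [k1 a2, k2 a2, k3 a3] at e3
    rw [k1 a2, k4 a3, k3 a3] at e4
    exact ⟨e1, e2, e3, e4⟩
  · rintro ⟨e1, e2, e3, e4⟩
    exact ⟨U, U', V, V', hU.isContRep, hU.isContRep_deriv, hV.isContRep, hV.isContRep_deriv,
      e1, e2, e3, e4⟩

/-- The energy estimate on one interval. -/
theorem IsClassicalRep.energy_le {a b : ℝ} (hab : a < b) {u : SobolevSpace 2 a b}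
    {U U' : ℝ → ℂ} (h : IsClassicalRep u U U') {m : ℝ} (hm : 0 < m) {μ : ℂ}
    (hμ : m * ‖μ‖ ≤ |μ.im|) : ‖μ‖ * ‖u.1 0‖ ^ 2 + ‖u.1 1‖ ^ 2 ≤
      (1 + 2 / m) * (‖U b‖ * ‖U' b‖ + ‖U a‖ * ‖U' a‖ + ‖u.1 0‖ * ‖μ • u.1 0 - u.1 2‖) := by
  refine (add_le_of_le_abs_im (b := ‖u.1 1‖ ^ 2) hm (sq_nonneg ‖u.1 0‖) hμ).trans ?_
  refine mul_le_mul_of_nonneg_left ?_ (by positivity)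
  have e1 : inner ℂ (u.1 0) (u.1 0) = ((‖u.1 0‖ ^ 2 : ℝ) : ℂ) :=
    (inner_self_eq_norm_sq_to_K _).trans (Complex.ofReal_pow _ _).symm
  have e2 : inner ℂ (u.1 1) (u.1 1) = ((‖u.1 1‖ ^ 2 : ℝ) : ℂ) :=
    (inner_self_eq_norm_sq_to_K _).trans (Complex.ofReal_pow _ _).symm
  have e : μ * ((‖u.1 0‖ ^ 2 : ℝ) : ℂ) + ((‖u.1 1‖ ^ 2 : ℝ) : ℂ) =
      (starRingEnd ℂ) (U b) * U' b - (starRingEnd ℂ) (U a) * U' a +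
        inner ℂ (u.1 0) (μ • u.1 0 - u.1 2) := by
    rw [← h.green hab, ← e1, ← e2, inner_sub_right, inner_smul_right]
    ring
  rw [e]
  refine (norm_add_le _ _).trans (add_le_add ((norm_sub_le _ _).trans_eq ?_)
    (norm_inner_le_norm _ _))
  rw [norm_mul, norm_mul, RCLike.norm_conj, RCLike.norm_conj]

/-- For `q ≠ 0` the condition expresses `y` through `x`. For `q = 0` it is the Dirichlet condition
`x = 0`, and the convention `p / 0 = 0` is harmless as both sides vanish. -/
theorem norm_mul_norm_le_of_robin {p q : ℝ} (h : |p| + |q| ≠ 0) {x y : ℂ}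
    (e : p * x + q * y = 0) : ‖x‖ * ‖y‖ ≤ |p / q| * ‖x‖ ^ 2 := by
  rcases eq_or_ne q 0 with rfl | hq
  · have hp : p ≠ 0 := by
      rintro rfl
      simp at h
    have : x = 0 := by simpa [hp] using e
    simp [this]
  · have hq' : (q : ℂ) ≠ 0 := Complex.ofReal_ne_zero.2 hq
    have hy : y = -((p / q : ℝ) : ℂ) * x := by
      push_cast
      field_simp
      linear_combination e
    rw [hy, norm_mul, norm_neg, Complex.norm_real, Real.norm_eq_abs]
    apply le_of_eq
    ring

/-- The transmission condition removes the derivative `x'`, leaving products of boundary values; `w`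
is the trace on the side where `x'` is taken. -/
theorem norm_mul_norm_le_of_transmission {p q X : ℝ} {x x' y : ℂ}
    (e : x' - p * x - q * y = 0) (w : ℂ) (hw : ‖w‖ ^ 2 ≤ X) (hx : ‖x‖ ^ 2 ≤ X)
    (hy : ‖y‖ ^ 2 ≤ X) : ‖w‖ * ‖x'‖ ≤ (|p| + |q|) * X := by
  have hX : x' = p * x + q * y := by linear_combination e
  have h1 : ‖x'‖ ≤ |p| * ‖x‖ + |q| * ‖y‖ := by
    rw [hX]
    refine (norm_add_le _ _).trans_eq ?_
    simp
  have h2 : ‖w‖ * ‖x‖ ≤ X := by nlinarith [sq_nonneg (‖w‖ - ‖x‖)]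
  have h3 : ‖w‖ * ‖y‖ ≤ X := by nlinarith [sq_nonneg (‖w‖ - ‖y‖)]
  calc ‖w‖ * ‖x'‖ ≤ ‖w‖ * (|p| * ‖x‖ + |q| * ‖y‖) := by gcongr
    _ = |p| * (‖w‖ * ‖x‖) + |q| * (‖w‖ * ‖y‖) := by ring
    _ ≤ |p| * X + |q| * X := by gcongr
    _ = _ := by ring

/-- `u ↦ z u - p(x) u''`. -/
def resolventPrincipal (c : TransmissionData) (z : ℂ) : W22Sum →ₗ[ℂ] L2Sum :=
  z • W22Sum.toL2 - principalPart c

theorem resolventPrincipal_fst (c : TransmissionData) (z : ℂ) (u : W22Sum) :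
    (resolventPrincipal c z u).fst = z • u.fst.1 0 - (c.p₁ : ℂ) • u.fst.1 2 := rfl

theorem resolventPrincipal_snd (c : TransmissionData) (z : ℂ) (u : W22Sum) :
    (resolventPrincipal c z u).snd = z • u.snd.1 0 - (c.p₂ : ℂ) • u.snd.1 2 := rfl

/-- Division by a real number of either sign preserves the double sector, so `p₁` and `p₂` may have
opposite signs. -/
theorem le_abs_im_div_ofReal {m p : ℝ} (hp : p ≠ 0) {z : ℂ} (hz : m * ‖z‖ ≤ |z.im|) :
    m * ‖z / (p : ℂ)‖ ≤ |(z / (p : ℂ)).im| := by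
  rw [norm_div, Complex.norm_real, Complex.div_ofReal_im, abs_div, Real.norm_eq_abs,
    ← mul_div_assoc]
  gcongr

theorem norm_div_smul_sub {E : Type*} [NormedAddCommGroup E] [NormedSpace ℂ E] {p : ℝ}
    (hp : p ≠ 0) (z : ℂ) (x y : E) : ‖(z / (p : ℂ)) • x - y‖ = |p|⁻¹ * ‖z • x - (p : ℂ) • y‖ := by
  have hp' : (p : ℂ) ≠ 0 := Complex.ofReal_ne_zero.2 hp
  have : (z / (p : ℂ)) • x - y = (p : ℂ)⁻¹ • (z • x - (p : ℂ) • y) := by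
    rw [smul_sub, smul_smul, smul_smul, inv_mul_cancel₀ hp', one_smul, div_eq_inv_mul]
  rw [this, norm_smul, norm_inv, Complex.norm_real, Real.norm_eq_abs]

/-- The choice of `t` gives `M B / t ≤ 1 / 2`, so the boundary terms cost at most half of the first
derivative terms. Here `qᵢ` stands for `1 / |pᵢ|`, `N` and `F` for the `L₂` norms of `u` and of `z u
- p u''`, and `T₁, …, T₄` for the boundary terms at `-1`, `0⁻`, `0⁺`, `1`. -/
theorem absorb_boundary_terms {M B q₁ q₂ Z N F u₀ v₀ u₁ v₁ f₁ f₂ T₁ T₂ T₃ T₄ t : ℝ}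
    (hM : 0 < M) (hB : 0 ≤ B) (hq₁ : 0 < q₁) (hq₂ : 0 < q₂) (hZ : 0 ≤ Z) (hN : 0 ≤ N)
    (hu₀ : 0 ≤ u₀) (hv₀ : 0 ≤ v₀) (hF : 0 ≤ F) (hf₁ : f₁ ≤ F) (hf₂ : f₂ ≤ F)
    (hN2 : N ^ 2 = u₀ ^ 2 + v₀ ^ 2) (ht : t = 2 * (M * B) + 1)
    (hT : T₁ + T₂ + T₃ + T₄ ≤ B * ((1 + t) * N ^ 2 + t⁻¹ * (u₁ ^ 2 + v₁ ^ 2)))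
    (E₁ : Z * q₁ * u₀ ^ 2 + u₁ ^ 2 ≤ M * (T₂ + T₁ + u₀ * (q₁ * f₁)))
    (E₂ : Z * q₂ * v₀ ^ 2 + v₁ ^ 2 ≤ M * (T₄ + T₃ + v₀ * (q₂ * f₂))) :
    min q₁ q₂ * Z * N ^ 2 + (u₁ ^ 2 + v₁ ^ 2) / 2 ≤
      M * B * (1 + t) * N ^ 2 + M * (q₁ + q₂) * (N * F) := by
  have ht0 : 0 < t := by rw [ht]; positivity
  have u0N : u₀ ≤ N := le_of_sq_le_sq (by linarith [sq_nonneg v₀]) hN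
  have v0N : v₀ ≤ N := le_of_sq_le_sq (by linarith [sq_nonneg u₀]) hN
  have g1 : u₀ * (q₁ * f₁) ≤ q₁ * (N * F) := by
    rw [mul_left_comm]
    exact mul_le_mul_of_nonneg_left
      ((mul_le_mul_of_nonneg_left hf₁ hu₀).trans (mul_le_mul_of_nonneg_right u0N hF)) hq₁.le
  have g2 : v₀ * (q₂ * f₂) ≤ q₂ * (N * F) := by
    rw [mul_left_comm]
    exact mul_le_mul_of_nonneg_left
      ((mul_le_mul_of_nonneg_left hf₂ hv₀).trans (mul_le_mul_of_nonneg_right v0N hF)) hq₂.le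
  have hk1 : min q₁ q₂ * (Z * u₀ ^ 2) ≤ q₁ * (Z * u₀ ^ 2) :=
    mul_le_mul_of_nonneg_right (min_le_left _ _) (by positivity)
  have hk2 : min q₁ q₂ * (Z * v₀ ^ 2) ≤ q₂ * (Z * v₀ ^ 2) :=
    mul_le_mul_of_nonneg_right (min_le_right _ _) (by positivity)
  have hsum := mul_le_mul_of_nonneg_left (add_le_add hT (add_le_add g1 g2)) hM.le
  have hMt : M * B * t⁻¹ ≤ 1 / 2 := by
    rw [← div_eq_mul_inv, div_le_iff₀ ht0]
    linarith
  have hfin : M * B * t⁻¹ * (u₁ ^ 2 + v₁ ^ 2) ≤ 1 / 2 * (u₁ ^ 2 + v₁ ^ 2) :=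
    mul_le_mul_of_nonneg_right hMt (by positivity)
  have e2 : min q₁ q₂ * Z * N ^ 2 =
      min q₁ q₂ * (Z * u₀ ^ 2) + min q₁ q₂ * (Z * v₀ ^ 2) := by rw [hN2]; ring
  rw [e2]
  linarith

theorem WithLp.norm_fst_le_of_L2 {E F : Type*} [NormedAddCommGroup E] [NormedAddCommGroup F]
    (x : WithLp 2 (E × F)) : ‖x.fst‖ ≤ ‖x‖ :=
  le_of_sq_le_sq (by rw [WithLp.prod_norm_sq_eq_of_L2]; linarith [sq_nonneg ‖x.snd‖])
    (norm_nonneg _)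

theorem WithLp.norm_snd_le_of_L2 {E F : Type*} [NormedAddCommGroup E] [NormedAddCommGroup F]
    (x : WithLp 2 (E × F)) : ‖x.snd‖ ≤ ‖x‖ :=
  le_of_sq_le_sq (by rw [WithLp.prod_norm_sq_eq_of_L2]; linarith [sq_nonneg ‖x.fst‖])
    (norm_nonneg _)

theorem boundary_terms_le {c : TransmissionData} (hα : |c.α₀| + |c.α₁| ≠ 0)
    (hβ : |c.β₀| + |c.β₁| ≠ 0) {u : W22Sum} (hu : u ∈ boundarySubmodule c) {U U' V V' : ℝ → ℂ}
    (hU : IsClassicalRep u.fst U U') (hV : IsClassicalRep u.snd V V') {t : ℝ} (ht : 0 < t) :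
    ‖U (-1)‖ * ‖U' (-1)‖ + ‖U 0‖ * ‖U' 0‖ + ‖V 0‖ * ‖V' 0‖ + ‖V 1‖ * ‖V' 1‖ ≤
      (|c.α₀ / c.α₁| + |c.β₀ / c.β₁| + (|c.γ₀| + |c.δ₀|) + (|c.γ₁| + |c.δ₁|)) *
        ((1 + t) * ‖W22Sum.toL2 u‖ ^ 2 + t⁻¹ * (‖u.fst.1 1‖ ^ 2 + ‖u.snd.1 1‖ ^ 2)) := by
  obtain ⟨b1, b2, b3, b4⟩ := (mem_boundarySubmodule_iff hU hV).1 hu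
  -- A common bound for all four squared traces is needed because the transmission conditions mix
  -- the two intervals.
  obtain ⟨X, hX⟩ : ∃ X, X = (1 + t) * ‖W22Sum.toL2 u‖ ^ 2 +
    t⁻¹ * (‖u.fst.1 1‖ ^ 2 + ‖u.snd.1 1‖ ^ 2) := ⟨_, rfl⟩
  have ti : 0 < t⁻¹ := inv_pos.2 ht
  have hX' : X = ((1 + t) * ‖u.fst.1 0‖ ^ 2 + t⁻¹ * ‖u.fst.1 1‖ ^ 2) +
      ((1 + t) * ‖u.snd.1 0‖ ^ 2 + t⁻¹ * ‖u.snd.1 1‖ ^ 2) := by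
    rw [hX, W22Sum.norm_toL2_sq]; ring
  have p1 : 0 ≤ (1 + t) * ‖u.fst.1 0‖ ^ 2 + t⁻¹ * ‖u.fst.1 1‖ ^ 2 := by positivity
  have p2 : 0 ≤ (1 + t) * ‖u.snd.1 0‖ ^ 2 + t⁻¹ * ‖u.snd.1 1‖ ^ 2 := by positivity
  have tU : ∀ x ∈ Icc (-1 : ℝ) 0, ‖U x‖ ^ 2 ≤ X := by
    intro x hx
    have := hU.norm_sq_le (by norm_num) ht hx
    rw [sub_neg_eq_add, zero_add, one_mul, one_mul, one_mul] at this
    exact this.trans (hX' ▸ le_add_of_nonneg_right p2)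
  have tV : ∀ x ∈ Icc (0 : ℝ) 1, ‖V x‖ ^ 2 ≤ X := by
    intro x hx
    have := hV.norm_sq_le (by norm_num) ht hx
    rw [sub_zero, one_mul, one_mul, one_mul] at this
    exact this.trans (hX' ▸ le_add_of_nonneg_left p1)
  have a1 := tU (-1) (by norm_num)
  have a2 := tU 0 (by norm_num)
  have a3 := tV 0 (by norm_num)
  have a4 := tV 1 (by norm_num)
  rw [← hX, add_mul, add_mul, add_mul]
  have d1 : ‖U (-1)‖ * ‖U' (-1)‖ ≤ |c.α₀ / c.α₁| * X :=
    (norm_mul_norm_le_of_robin hα b1).trans (mul_le_mul_of_nonneg_left a1 (abs_nonneg _))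
  have d2 : ‖V 1‖ * ‖V' 1‖ ≤ |c.β₀ / c.β₁| * X :=
    (norm_mul_norm_le_of_robin hβ b2).trans (mul_le_mul_of_nonneg_left a4 (abs_nonneg _))
  have d3 := norm_mul_norm_le_of_transmission b3 _ a2 a2 a3
  have d4 : ‖V 0‖ * ‖V' 0‖ ≤ (|c.γ₁| + |c.δ₁|) * X :=
    norm_mul_norm_le_of_transmission b4 _ a3 a2 a3
  linarith

/-- The energy estimate with the boundary terms absorbed. -/
theorem energy_le_of_mem_boundarySubmodule {c : TransmissionData} (hp₁ : c.p₁ ≠ 0)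
    (hp₂ : c.p₂ ≠ 0) (hα : |c.α₀| + |c.α₁| ≠ 0) (hβ : |c.β₀| + |c.β₁| ≠ 0) {m : ℝ} (hm : 0 < m) :
    ∃ k K L : ℝ, 0 < k ∧ 0 ≤ K ∧ 0 ≤ L ∧ ∀ z : ℂ, m * ‖z‖ ≤ |z.im| →
      ∀ u ∈ boundarySubmodule c,
        k * ‖z‖ * ‖W22Sum.toL2 u‖ ^ 2 + (‖u.fst.1 1‖ ^ 2 + ‖u.snd.1 1‖ ^ 2) / 2 ≤
          K * ‖W22Sum.toL2 u‖ ^ 2 + L * (‖W22Sum.toL2 u‖ * ‖resolventPrincipal c z u‖) := by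
  obtain ⟨M, hM⟩ : ∃ M, M = 1 + 2 / m := ⟨_, rfl⟩
  have hM0 : 0 < M := by rw [hM]; positivity
  obtain ⟨B, hB⟩ : ∃ B, B = |c.α₀ / c.α₁| + |c.β₀ / c.β₁| + (|c.γ₀| + |c.δ₀|) +
    (|c.γ₁| + |c.δ₁|) := ⟨_, rfl⟩
  have hB0 : 0 ≤ B := by rw [hB]; positivity
  obtain ⟨t, ht⟩ : ∃ t, t = 2 * (M * B) + 1 := ⟨_, rfl⟩
  have ht0 : 0 < t := by rw [ht]; positivity
  have q1 : 0 < |c.p₁|⁻¹ := inv_pos.2 (abs_pos.2 hp₁)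
  have q2 : 0 < |c.p₂|⁻¹ := inv_pos.2 (abs_pos.2 hp₂)
  refine ⟨min |c.p₁|⁻¹ |c.p₂|⁻¹, M * B * (1 + t), M * (|c.p₁|⁻¹ + |c.p₂|⁻¹), lt_min q1 q2,
    by positivity, by positivity, ?_⟩
  intro z hz u hu
  obtain ⟨U, U', hU⟩ := SobolevSpace.exists_isClassicalRep (by norm_num) u.fst
  obtain ⟨V, V', hV⟩ := SobolevSpace.exists_isClassicalRep (by norm_num) u.snd
  have E1 := hU.energy_le (by norm_num) hm (le_abs_im_div_ofReal hp₁ hz)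
  have E2 := hV.energy_le (by norm_num) hm (le_abs_im_div_ofReal hp₂ hz)
  rw [norm_div_smul_sub hp₁, ← resolventPrincipal_fst, norm_div, Complex.norm_real,
    Real.norm_eq_abs, div_eq_mul_inv, ← hM] at E1
  rw [norm_div_smul_sub hp₂, ← resolventPrincipal_snd, norm_div, Complex.norm_real,
    Real.norm_eq_abs, div_eq_mul_inv, ← hM] at E2
  have hT := boundary_terms_le hα hβ hu hU hV ht0
  rw [← hB] at hT
  exact absorb_boundary_terms hM0 hB0 q1 q2 (norm_nonneg z) (norm_nonneg _) (norm_nonneg _)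
    (norm_nonneg _) (norm_nonneg _) (WithLp.norm_fst_le_of_L2 _) (WithLp.norm_snd_le_of_L2 _)
    (W22Sum.norm_toL2_sq u) ht hT E1 E2

/-- For `Z > 2 K / k` the term `K N²` is absorbed by half of `k Z N²`, and one factor `N` cancels.
The extra `1` ensures `Z ≥ 1`, so `N` itself is bounded as well. -/
theorem norm_le_of_energy_le {k K L Z N F D : ℝ} (hk : 0 < k) (hK : 0 ≤ K) (hL : 0 ≤ L)
    (hN : 0 ≤ N) (hF : 0 ≤ F) (hD : 0 ≤ D) (hZ : 2 * K / k + 1 < Z)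
    (h : k * Z * N ^ 2 + D / 2 ≤ K * N ^ 2 + L * (N * F)) :
    Z * N ≤ 2 * L / k * F ∧ N ≤ 2 * L / k * F ∧ D ≤ 2 * L * (2 * L / k) * F ^ 2 := by
  have hKk : 0 ≤ 2 * K / k := by positivity
  have hZ1 : 1 ≤ Z := by linarith
  have hKz : K ≤ k * Z / 2 := by
    have : 2 * K / k ≤ Z := by linarith
    rw [div_le_iff₀ hk] at this
    linarith
  have hKN : K * N ^ 2 ≤ k * Z / 2 * N ^ 2 := mul_le_mul_of_nonneg_right hKz (sq_nonneg N)
  have hzN : Z * N ≤ 2 * L / k * F := by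
    rcases hN.eq_or_lt with h0 | h0
    · rw [← h0, mul_zero]
      positivity
    · have h1 : N * (k * (Z * N)) ≤ N * (2 * L * F) := by linarith
      have h2 := le_of_mul_le_mul_left h1 h0
      rw [div_mul_eq_mul_div, le_div_iff₀ hk]
      linarith
  have hNF : N ≤ 2 * L / k * F := (le_mul_of_one_le_left hN hZ1).trans hzN
  refine ⟨hzN, hNF, ?_⟩
  have h1 : L * (N * F) ≤ L * (2 * L / k * F * F) := by gcongr
  have h2 : 0 ≤ k * Z / 2 * N ^ 2 := by positivity
  linarith

/-- The equation gives the second derivative: `p y` is the difference of `z x` and the right-hand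
side. -/
theorem norm_second_deriv_sq_le {E : Type*} [NormedAddCommGroup E] [NormedSpace ℂ E] {p C N F : ℝ}
    (hp : p ≠ 0) {z : ℂ} {x y : E} (hg : ‖z • x - (p : ℂ) • y‖ ≤ F) (hx : ‖x‖ ≤ N)
    (hN : ‖z‖ * N ≤ C * F) : ‖y‖ ^ 2 ≤ (|p|⁻¹ * (C + 1)) ^ 2 * F ^ 2 := by
  rw [← mul_pow]
  refine pow_le_pow_left₀ (norm_nonneg _) ?_ 2
  have hp' : 0 < |p| := abs_pos.2 hp
  have e : |p| * ‖y‖ = ‖z • x - (z • x - (p : ℂ) • y)‖ := by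
    rw [sub_sub_cancel, norm_smul, Complex.norm_real, Real.norm_eq_abs]
  have h1 : |p| * ‖y‖ ≤ (C + 1) * F := by
    rw [e]
    refine (norm_sub_le _ _).trans ?_
    rw [norm_smul]
    linarith [mul_le_mul_of_nonneg_left hx (norm_nonneg z)]
  rw [mul_assoc, ← div_eq_inv_mul, le_div_iff₀ hp']
  linarith

/-- The a priori estimate for the principal part. -/
theorem exists_apriori_estimate {c : TransmissionData} (hp₁ : c.p₁ ≠ 0)
    (hp₂ : c.p₂ ≠ 0) (hα : |c.α₀| + |c.α₁| ≠ 0) (hβ : |c.β₀| + |c.β₁| ≠ 0) {m : ℝ} (hm : 0 < m) :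
    ∃ R C : ℝ, 0 < R ∧ 0 < C ∧ ∀ z : ℂ, m * ‖z‖ ≤ |z.im| → R < ‖z‖ →
      ∀ u ∈ boundarySubmodule c,
        ‖z‖ * ‖W22Sum.toL2 u‖ ≤ C * ‖resolventPrincipal c z u‖ ∧
          ‖u‖ ≤ C * ‖resolventPrincipal c z u‖ := by
  obtain ⟨k, K, L, hk, hK, hL, H⟩ := energy_le_of_mem_boundarySubmodule hp₁ hp₂ hα hβ hm
  obtain ⟨C₁, hC₁⟩ : ∃ C₁, C₁ = 2 * L / k := ⟨_, rfl⟩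
  have hC₁0 : 0 ≤ C₁ := by rw [hC₁]; positivity
  -- The summands bound the squared norms of `u`, of `u'`, and of `u''` on each interval.
  obtain ⟨S, hS⟩ : ∃ S, S = C₁ ^ 2 + 2 * L * C₁ + (|c.p₁|⁻¹ * (C₁ + 1)) ^ 2 +
    (|c.p₂|⁻¹ * (C₁ + 1)) ^ 2 := ⟨_, rfl⟩
  have hS0 : 0 ≤ S := by rw [hS]; positivity
  -- `C₁ + S + 1` exceeds `C₁` and has square at least `S`, so it serves both estimates.
  refine ⟨2 * K / k + 1, C₁ + S + 1, by positivity, by positivity, ?_⟩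
  intro z hz hR u hu
  have hF := norm_nonneg (resolventPrincipal c z u)
  obtain ⟨hzN, hNf, hD⟩ := norm_le_of_energy_le hk hK hL (norm_nonneg _) hF (by positivity) hR
    (H z hz u hu)
  rw [← hC₁] at hzN hNf hD
  have t1 := norm_second_deriv_sq_le hp₁ (z := z) (x := u.fst.1 0) (y := u.fst.1 2)
    (WithLp.norm_fst_le_of_L2 (resolventPrincipal c z u))
    (WithLp.norm_fst_le_of_L2 (W22Sum.toL2 u)) hzN
  have t2 := norm_second_deriv_sq_le hp₂ (z := z) (x := u.snd.1 0) (y := u.snd.1 2)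
    (WithLp.norm_snd_le_of_L2 (resolventPrincipal c z u))
    (WithLp.norm_snd_le_of_L2 (W22Sum.toL2 u)) hzN
  have hN2 := pow_le_pow_left₀ (norm_nonneg _) hNf 2
  rw [mul_pow, W22Sum.norm_toL2_sq] at hN2
  have hu2 : ‖u‖ ^ 2 ≤ S * ‖resolventPrincipal c z u‖ ^ 2 := by
    rw [W22Sum.norm_sq, hS]
    linarith
  have hC : C₁ ≤ C₁ + S + 1 := by linarith
  refine ⟨hzN.trans (mul_le_mul_of_nonneg_right hC hF),
    le_of_sq_le_sq (hu2.trans ?_) (by positivity)⟩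
  rw [mul_pow]
  refine mul_le_mul_of_nonneg_right ?_ (sq_nonneg _)
  nlinarith

/-! ### Solvability of the boundary value problem for the principal part. -/

theorem exists_sq_eq (w : ℂ) : ∃ κ : ℂ, κ ^ 2 = w :=
  IsAlgClosed.exists_pow_nat_eq w two_pos

/-- The four boundary forms evaluated at the solution with coefficients `w` of the homogeneous
equation. -/
def boundaryMatrix (c : TransmissionData) (κ τ : ℂ) : (ℂ × ℂ) × ℂ × ℂ →ₗ[ℂ] (ℂ × ℂ) × ℂ × ℂ :=
  let F (k x : ℂ) (w : ℂ × ℂ) : ℂ := w.1 * Complex.exp (k * x) + w.2 * Complex.exp (-k * x)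
  let F' (k x : ℂ) (w : ℂ × ℂ) : ℂ :=
    k * (w.1 * Complex.exp (k * x) - w.2 * Complex.exp (-k * x))
  { toFun := fun w =>
      ((c.α₀ * F κ (-1) w.1 + c.α₁ * F' κ (-1) w.1, c.β₀ * F τ 1 w.2 + c.β₁ * F' τ 1 w.2),
        F' κ 0 w.1 - c.γ₀ * F κ 0 w.1 - c.δ₀ * F τ 0 w.2,
        F' τ 0 w.2 - c.γ₁ * F κ 0 w.1 - c.δ₁ * F τ 0 w.2)
    map_add' := fun v w => by
      refine Prod.ext (Prod.ext ?_ ?_) (Prod.ext ?_ ?_) <;>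
        simp only [F, F', Prod.fst_add, Prod.snd_add] <;> ring
    map_smul' := fun r w => by
      refine Prod.ext (Prod.ext ?_ ?_) (Prod.ext ?_ ?_) <;>
        simp only [F, F', Prod.smul_fst, Prod.smul_snd, smul_eq_mul, RingHom.id_apply] <;> ring }

theorem exists_homogeneous_solution_sum {c : TransmissionData} (hp₁ : c.p₁ ≠ 0)
    (hp₂ : c.p₂ ≠ 0) {z κ τ : ℂ} (hκ : κ ^ 2 = z / c.p₁) (hτ : τ ^ 2 = z / c.p₂)
    (w : (ℂ × ℂ) × ℂ × ℂ) : ∃ u : W22Sum, resolventPrincipal c z u = 0 ∧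
      IsClassicalRep u.fst
        (fun x => w.1.1 * Complex.exp (κ * x) + w.1.2 * Complex.exp (-κ * x))
        (fun x => κ * (w.1.1 * Complex.exp (κ * x) - w.1.2 * Complex.exp (-κ * x))) ∧
      IsClassicalRep u.snd
        (fun x => w.2.1 * Complex.exp (τ * x) + w.2.2 * Complex.exp (-τ * x))
        (fun x => τ * (w.2.1 * Complex.exp (τ * x) - w.2.2 * Complex.exp (-τ * x))) := by
  obtain ⟨u, hu, hU⟩ := exists_homogeneous_solution (a := -1) (b := 0) (by norm_num) κ w.1.1 w.1.2
  obtain ⟨v, hv, hV⟩ := exists_homogeneous_solution (a := 0) (b := 1) (by norm_num) τ w.2.1 w.2.2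
  refine ⟨WithLp.toLp 2 (u, v), WithLp.ofLp_injective 2 (Prod.ext ?_ ?_), hU, hV⟩
  · change z • u.1 0 - (c.p₁ : ℂ) • u.1 2 = 0
    rw [← norm_eq_zero] at hu ⊢
    rw [hκ, norm_div_smul_sub hp₁] at hu
    simpa [hp₁] using hu
  · change z • v.1 0 - (c.p₂ : ℂ) • v.1 2 = 0
    rw [← norm_eq_zero] at hv ⊢
    rw [hτ, norm_div_smul_sub hp₂] at hv
    simpa [hp₂] using hv

theorem exists_particular_solution_sum {c : TransmissionData} (hp₁ : c.p₁ ≠ 0)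
    (hp₂ : c.p₂ ≠ 0) {z κ τ : ℂ} (hz : z ≠ 0) (hκ : κ ^ 2 = z / c.p₁) (hτ : τ ^ 2 = z / c.p₂)
    (f : L2Sum) : ∃ u : W22Sum, resolventPrincipal c z u = f := by
  have hp₁' : (c.p₁ : ℂ) ≠ 0 := Complex.ofReal_ne_zero.2 hp₁
  have hp₂' : (c.p₂ : ℂ) ≠ 0 := Complex.ofReal_ne_zero.2 hp₂
  have hκ0 : κ ≠ 0 := by
    rintro rfl
    exact div_ne_zero hz hp₁' (by rw [← hκ]; simp)
  have hτ0 : τ ≠ 0 := by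
    rintro rfl
    exact div_ne_zero hz hp₂' (by rw [← hτ]; simp)
  obtain ⟨u, hu⟩ := exists_particular_solution (a := -1) (b := 0) (by norm_num) hκ0
    ((c.p₁ : ℂ)⁻¹ • f.fst)
  obtain ⟨v, hv⟩ := exists_particular_solution (a := 0) (b := 1) (by norm_num) hτ0
    ((c.p₂ : ℂ)⁻¹ • f.snd)
  refine ⟨WithLp.toLp 2 (u, v), WithLp.ofLp_injective 2 (Prod.ext ?_ ?_)⟩
  · change z • u.1 0 - (c.p₁ : ℂ) • u.1 2 = f.fst
    rw [hκ, eq_inv_smul_iff₀ hp₁', smul_sub, smul_smul, mul_div_cancel₀ _ hp₁'] at hu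
    exact hu
  · change z • v.1 0 - (c.p₂ : ℂ) • v.1 2 = f.snd
    rw [hτ, eq_inv_smul_iff₀ hp₂', smul_sub, smul_smul, mul_div_cancel₀ _ hp₂'] at hv
    exact hv

theorem eq_zero_of_exp_combination_eq_zero {a b : ℝ} (hab : a < b) {κ c₁ c₂ : ℂ} (hκ : κ ≠ 0)
    (h : ∀ x ∈ Icc a b, c₁ * Complex.exp (κ * x) + c₂ * Complex.exp (-κ * x) = 0)
    (h' : ∀ x ∈ Icc a b, κ * (c₁ * Complex.exp (κ * x) - c₂ * Complex.exp (-κ * x)) = 0) :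
    c₁ = 0 ∧ c₂ = 0 := by
  have ha : a ∈ Icc a b := ⟨le_rfl, hab.le⟩
  have h1 := h a ha
  have h2 := (mul_eq_zero.1 (h' a ha)).resolve_left hκ
  have e1 : c₁ * Complex.exp (κ * a) = 0 := by linear_combination (h1 + h2) / 2
  have e2 : c₂ * Complex.exp (-κ * a) = 0 := by linear_combination (h1 - h2) / 2
  exact ⟨(mul_eq_zero.1 e1).resolve_right (Complex.exp_ne_zero _),
    (mul_eq_zero.1 e2).resolve_right (Complex.exp_ne_zero _)⟩

/-- Uniqueness implies existence: the boundary forms on the four-dimensional space of homogeneous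
solutions give an endomorphism, so injectivity suffices and no determinant has to be computed. -/
theorem exists_mem_boundarySubmodule_resolventPrincipal_eq {c : TransmissionData}
    (hp₁ : c.p₁ ≠ 0) (hp₂ : c.p₂ ≠ 0) {z : ℂ} (hz : z ≠ 0)
    (hinj : ∀ u ∈ boundarySubmodule c, resolventPrincipal c z u = 0 → u = 0) (f : L2Sum) :
    ∃ u ∈ boundarySubmodule c, resolventPrincipal c z u = f := by
  obtain ⟨κ, hκ⟩ := exists_sq_eq (z / c.p₁)
  obtain ⟨τ, hτ⟩ := exists_sq_eq (z / c.p₂)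
  have hκ0 : κ ≠ 0 := by
    rintro rfl
    exact div_ne_zero hz (Complex.ofReal_ne_zero.2 hp₁) (by rw [← hκ]; simp)
  have hτ0 : τ ≠ 0 := by
    rintro rfl
    exact div_ne_zero hz (Complex.ofReal_ne_zero.2 hp₂) (by rw [← hτ]; simp)
  have hM : Function.Injective (boundaryMatrix c κ τ) := by
    rw [← LinearMap.ker_eq_bot, LinearMap.ker_eq_bot']
    intro w hw
    -- A kernel vector gives a homogeneous solution satisfying all conditions; by `hinj` it is zero,
    -- and then so are its coefficients.
    obtain ⟨u, hu, hU, hV⟩ := exists_homogeneous_solution_sum hp₁ hp₂ hκ hτ w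
    have hmem : u ∈ boundarySubmodule c := by
      rw [mem_boundarySubmodule_iff hU hV]
      have h1 := congrArg (fun v => v.1.1) hw
      have h2 := congrArg (fun v => v.1.2) hw
      have h3 := congrArg (fun v => v.2.1) hw
      have h4 := congrArg (fun v => v.2.2) hw
      simp only [Complex.ofReal_neg, Complex.ofReal_one, Complex.ofReal_zero]
      exact ⟨h1, h2, h3, h4⟩
    have hu0 := hinj u hmem hu
    subst hu0
    obtain ⟨e1, e2⟩ := eq_zero_of_exp_combination_eq_zero (a := -1) (b := 0) (by norm_num) hκ0
      (hU.isContRep.eqOn (by norm_num) IsContRep.zero)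
      (hU.isContRep_deriv.eqOn (by norm_num) IsContRep.zero)
    obtain ⟨e3, e4⟩ := eq_zero_of_exp_combination_eq_zero (a := 0) (b := 1) (by norm_num) hτ0
      (hV.isContRep.eqOn (by norm_num) IsContRep.zero)
      (hV.isContRep_deriv.eqOn (by norm_num) IsContRep.zero)
    exact Prod.ext (Prod.ext e1 e2) (Prod.ext e3 e4)
  obtain ⟨v, hv⟩ := exists_particular_solution_sum hp₁ hp₂ hz hκ hτ f
  obtain ⟨X, X', hX⟩ := SobolevSpace.exists_isClassicalRep (by norm_num) v.fst
  obtain ⟨Y, Y', hY⟩ := SobolevSpace.exists_isClassicalRep (by norm_num) v.snd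
  -- The homogeneous solution is chosen to cancel the boundary forms of the particular one.
  obtain ⟨w, hw⟩ := LinearMap.injective_iff_surjective.1 hM
    ((-(c.α₀ * X (-1) + c.α₁ * X' (-1)), -(c.β₀ * Y 1 + c.β₁ * Y' 1)),
      -(X' 0 - c.γ₀ * X 0 - c.δ₀ * Y 0), -(Y' 0 - c.γ₁ * X 0 - c.δ₁ * Y 0))
  obtain ⟨u, hu, hU, hV⟩ := exists_homogeneous_solution_sum hp₁ hp₂ hκ hτ w
  refine ⟨v + u, ?_, by rw [map_add, hu, hv, add_zero]⟩
  rw [mem_boundarySubmodule_iff (u := v + u) (hX.add hU) (hY.add hV)]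
  have h1 := congrArg (fun v => v.1.1) hw
  have h2 := congrArg (fun v => v.1.2) hw
  have h3 := congrArg (fun v => v.2.1) hw
  have h4 := congrArg (fun v => v.2.2) hw
  simp only [boundaryMatrix, LinearMap.coe_mk, AddHom.coe_mk] at h1 h2 h3 h4
  simp only [Pi.add_apply, Complex.ofReal_neg, Complex.ofReal_one, Complex.ofReal_zero]
  exact ⟨by linear_combination h1, by linear_combination h2, by linear_combination h3,
    by linear_combination h4⟩

/-! ### Perturbation by `A` and the resolvent. -/

theorem transmissionOperator_apply {c : TransmissionData} {A : W22Sum →ₗ[ℂ] L2Sum} {u : W22Sum}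
    (hu : u ∈ boundarySubmodule c) (h : W22Sum.toL2 u ∈ (transmissionOperator c A).domain) :
    transmissionOperator c A ⟨W22Sum.toL2 u, h⟩ = principalPart c u + A u := by
  have e : ((boundarySubmodule c).equivMapOfInjective W22Sum.toL2
      W22Sum.toL2_injective).symm ⟨W22Sum.toL2 u, h⟩ = ⟨u, hu⟩ := by
    rw [LinearEquiv.symm_apply_eq]
    rfl
  change (principalPart c + A) (((boundarySubmodule c).equivMapOfInjective W22Sum.toL2
      W22Sum.toL2_injective).symm ⟨W22Sum.toL2 u, h⟩ : boundarySubmodule c) = _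
  rw [e]
  rfl

/-- Perturbation of the resolvent of the principal part by a relatively small operator. -/
theorem exists_isResolventAt {c : TransmissionData} {A : W22Sum →ₗ[ℂ] L2Sum} {z : ℂ} {q : ℝ}
    (hq0 : 0 ≤ q) (hsurj : ∀ f, ∃ u ∈ boundarySubmodule c, resolventPrincipal c z u = f)
    (hq : ∀ u ∈ boundarySubmodule c,
      ‖W22Sum.toL2 u‖ ≤ q * ‖resolventPrincipal c z u‖)
    (hA : ∀ u ∈ boundarySubmodule c, ‖A u‖ ≤ 1 / 2 * ‖resolventPrincipal c z u‖) :
    ∃ R, IsResolventAt (transmissionOperator c A) z R ∧ ‖R‖ ≤ 2 * q := by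
  have hinj : ∀ u ∈ boundarySubmodule c, resolventPrincipal c z u = 0 → u = 0 := by
    intro u hu h
    have := hq u hu
    rw [h, norm_zero, mul_zero, norm_le_zero_iff] at this
    exact W22Sum.toL2_injective (this.trans (map_zero _).symm)
  let e : boundarySubmodule c ≃ₗ[ℂ] L2Sum :=
    LinearEquiv.ofBijective (resolventPrincipal c z ∘ₗ (boundarySubmodule c).subtype)
      ⟨by
        rw [← LinearMap.ker_eq_bot, LinearMap.ker_eq_bot']
        exact fun u hu => Subtype.ext (hinj u u.2 hu), fun f => by
        obtain ⟨u, hu, h⟩ := hsurj f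
        exact ⟨⟨u, hu⟩, h⟩⟩
  have he : ∀ f, resolventPrincipal c z (e.symm f : W22Sum) = f := fun f => e.apply_symm_apply f
  have he' : ∀ u (hu : u ∈ boundarySubmodule c),
      (e.symm (resolventPrincipal c z u) : W22Sum) = u := fun u hu =>
    congrArg Subtype.val (e.symm_apply_apply ⟨u, hu⟩)
  -- `T` is `A` composed with the inverse of the principal part; below, `J` is that inverse viewed
  -- in `L₂`.
  let T : L2Sum →L[ℂ] L2Sum :=
    (A ∘ₗ (boundarySubmodule c).subtype ∘ₗ e.symm.toLinearMap).mkContinuous (1 / 2) fun f => by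
      have := hA _ (e.symm f).2
      rwa [he] at this
  have hT : ∀ f, T f = A (e.symm f : W22Sum) := fun _ => rfl
  have hTn : ‖T‖ ≤ 1 / 2 := LinearMap.mkContinuous_norm_le _ (by norm_num) _
  let J : L2Sum →L[ℂ] L2Sum :=
    (W22Sum.toL2 ∘ₗ (boundarySubmodule c).subtype ∘ₗ e.symm.toLinearMap).mkContinuous q fun f => by
      have := hq _ (e.symm f).2
      rwa [he] at this
  have hJ : ∀ f, J f = W22Sum.toL2 (e.symm f : W22Sum) := fun _ => rfl
  -- On the domain, `z` minus the full operator is `1 - T` after `resolventPrincipal c z`, so its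
  -- inverse is `J (1 - T)⁻¹`, with the Neumann series inverting `1 - T`.
  let S : (L2Sum →L[ℂ] L2Sum)ˣ := Units.oneSub T (lt_of_le_of_lt hTn (by norm_num))
  let S' : L2Sum →L[ℂ] L2Sum := ↑S⁻¹
  have hS : ∀ f, S' f - T (S' f) = f := fun f => by
    have : (S : L2Sum →L[ℂ] L2Sum) * S' = 1 := S.mul_inv
    exact congrArg (fun B : L2Sum →L[ℂ] L2Sum => B f) this
  have hS' : ∀ f, S' (f - T f) = f := fun f => by
    have : S' * (S : L2Sum →L[ℂ] L2Sum) = 1 := S.inv_mul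
    exact congrArg (fun B : L2Sum →L[ℂ] L2Sum => B f) this
  have hres : ∀ u (hu : u ∈ boundarySubmodule c)
      (h : W22Sum.toL2 u ∈ (transmissionOperator c A).domain),
      z • W22Sum.toL2 u - transmissionOperator c A ⟨W22Sum.toL2 u, h⟩ =
        resolventPrincipal c z u - A u := by
    intro u hu h
    rw [transmissionOperator_apply hu, ← sub_sub]
    rfl
  refine ⟨J ∘L S', ⟨fun f => ?_, ?_⟩, ?_⟩
  · refine ⟨⟨_, (e.symm (S' f)).2, rfl⟩, ?_⟩
    exact (hres _ (e.symm (S' f)).2 _).trans (by rw [he, ← hT]; exact hS f)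
  · rintro ⟨_, u, hu, rfl⟩
    have h1 := hres u hu ⟨u, hu, rfl⟩
    change J (S' (z • W22Sum.toL2 u - transmissionOperator c A ⟨W22Sum.toL2 u, _⟩)) =
      W22Sum.toL2 u
    rw [h1]
    have h2 : A u = T (resolventPrincipal c z u) := by rw [hT, he' u hu]
    rw [h2, hS', hJ, he' u hu]
  · have hS2 : ∀ f, ‖S' f‖ ≤ 2 * ‖f‖ := by
      intro f
      have h1 : ‖S' f‖ ≤ ‖f‖ + ‖T (S' f)‖ := by
        conv_lhs => rw [← sub_add_cancel (S' f) (T (S' f)), hS f]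
        exact norm_add_le _ _
      have h2 := T.le_of_opNorm_le hTn (S' f)
      linarith
    refine ContinuousLinearMap.opNorm_le_bound _ (by positivity) fun f => ?_
    have h1 := hq _ (e.symm (S' f)).2
    rw [he, ← hJ] at h1
    calc ‖J (S' f)‖ ≤ q * (2 * ‖f‖) := h1.trans (mul_le_mul_of_nonneg_left (hS2 f) hq0)
      _ = 2 * q * ‖f‖ := by ring

end

theorem mainTheorem7 (c : TransmissionData)
    (hp₁ : c.p₁ ≠ 0) (hp₂ : c.p₂ ≠ 0)
    (hα : |c.α₀| + |c.α₁| ≠ 0) (hβ : |c.β₀| + |c.β₁| ≠ 0)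
    (hpδγ : c.p₁ * c.δ₀ = c.p₂ * c.γ₁)
    (A : W22Sum →ₗ[ℂ] L2Sum) (hA : IsCompactOperator A) :
    ∀ ε : ℝ, 0 < ε → ∃ R C : ℝ, 0 < R ∧ 0 < C ∧
      ∀ z : ℂ, ε < |Complex.arg z| → ε < |Complex.arg (-z)| → R < ‖z‖ →
        IsRegularValue (transmissionOperator c A) z ∧
        ‖resolventOperator (transmissionOperator c A) z‖ ≤ C * ‖z‖⁻¹ := by
  
  intro ε hε
  obtain ⟨m, hm, hsec⟩ := exists_mul_norm_le_abs_im hε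
  obtain ⟨R, C, hR, hC, H⟩ := exists_apriori_estimate hp₁ hp₂ hα hβ hm
  -- With `η = 1 / (4 C)` the `W₂²` term of Ehrling's inequality is at most a quarter of
  -- `‖resolventPrincipal c z u‖`.
  obtain ⟨D, hD, hAD⟩ := W22Sum.exists_norm_le_add hA (η := 1 / (4 * C)) (by positivity)
  -- Beyond `4 D C` the `L₂` term contributes at most another quarter; the constant `2 C` carries
  -- the factor `2` from the Neumann series.
  refine ⟨R + 4 * D * C, 2 * C, by positivity, by positivity, fun z h1 h2 hz => ?_⟩
  have hRz : R < ‖z‖ := lt_of_le_of_lt (le_add_of_nonneg_right (by positivity)) hz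
  have hDz : 4 * D * C ≤ ‖z‖ := by linarith
  have hz0 : 0 < ‖z‖ := hR.trans hRz
  have Hz := H z (hsec z h1 h2) hRz
  have hq : ∀ u ∈ boundarySubmodule c,
      ‖W22Sum.toL2 u‖ ≤ C * ‖z‖⁻¹ * ‖resolventPrincipal c z u‖ := by
    intro u hu
    rw [mul_right_comm, ← div_eq_mul_inv, le_div_iff₀ hz0, mul_comm]
    exact (Hz u hu).1
  have hA' : ∀ u ∈ boundarySubmodule c, ‖A u‖ ≤ 1 / 2 * ‖resolventPrincipal c z u‖ := by
    intro u hu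
    have hF := norm_nonneg (resolventPrincipal c z u)
    have k1 : 1 / (4 * C) * ‖u‖ ≤ 1 / (4 * C) * (C * ‖resolventPrincipal c z u‖) :=
      mul_le_mul_of_nonneg_left (Hz u hu).2 (by positivity)
    have k2 : D * ‖W22Sum.toL2 u‖ ≤ D * (C * ‖z‖⁻¹ * ‖resolventPrincipal c z u‖) :=
      mul_le_mul_of_nonneg_left (hq u hu) hD
    have k3 : 1 / (4 * C) * (C * ‖resolventPrincipal c z u‖) =
        1 / 4 * ‖resolventPrincipal c z u‖ := by field_simp
    have k4 : D * (C * ‖z‖⁻¹) ≤ 1 / 4 := by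
      rw [← mul_assoc, ← div_eq_mul_inv, div_le_iff₀ hz0]
      linarith
    have k5 := mul_le_mul_of_nonneg_right k4 hF
    have := hAD u
    linarith
  have hsurj := exists_mem_boundarySubmodule_resolventPrincipal_eq hp₁ hp₂ (norm_pos_iff.1 hz0)
    (fun u hu h => by
      have := (Hz u hu).2
      rwa [h, norm_zero, mul_zero, norm_le_zero_iff] at this)
  obtain ⟨S, hS, hSn⟩ := exists_isResolventAt (q := C * ‖z‖⁻¹) (by positivity) hsurj hq hA'
  exact ⟨⟨S, hS⟩, by rw [← hS.eq_resolventOperator, mul_assoc]; exact hSn⟩
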